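/- Let $\Omega\subset\mathbb R^2$ be open, let $\varphi, A^{ij}, B^l, C\in C^\infty(\Omega)$ ($i,j,l\in\{1,2\}$), and suppose that for some $\lambda_0>0$ $$\sum_{i,j}A^{ij}(\xi)\eta_i\eta_j\ge\lambda_0|\eta|^2\qquad(\xi\in\Omega,\ \eta\in\mathbb R^2).$$ Let $\Gamma=\{\xi\in\Omega:\varphi(\xi)=0\}$ be a smooth (regular, simple) closed curve with $\nabla\varphi\neq0$ on $\Gamma$, let $\vec n=\nabla\varphi/|\nabla\varphi|$ on $\Gamma$, and let $$Lu=\varphi\Big(\sum_{i,j}A^{ij}u_{\xi_i\xi_j}+Cu\Big)+\sum_l B^l u_{\xi_l}.$$ Then there are a parametrization $\nu:\mathbb R\to\Gamma$ by arc length, periodic with period the length $l$ of $\Gamma$, and a number $d_0>0$ with the following properties. (i) *Normal coordinates.* Put $X(s_1,s_2)=\nu(s_1)+s_2\,\vec n(\nu(s_1))$ and $\mathcal N_0(\Gamma)=X(\mathbb R\times(-d_0,d_0))$. Then $\mathcal N_0(\Gamma)$ is open and $\Gamma\subset\mathcal N_0(\Gamma)\subset\Omega$. On $\mathbb R\times(-d_0,d_0)$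 the map $X$ is smooth with invertible Jacobian matrix, and $X(s)=X(t)$ holds exactly when $s_2=t_2$ and $t_1-s_1\in l\mathbb Z$. (ii) *Cauchy problem.* Let $\widetilde A^{ij}=\sum_{p,r}A^{pr}\,\frac{\partial s_i}{\partial\xi_p}\frac{\partial s_j}{\partial\xi_r}$ be the principal coefficients in the coordinates $s$ (with $\xi=X(s)$). There is a smooth $\psi:\mathbb R\times(-d_0,d_0)\to\mathbb R$ with $$\tfrac12\big(\widetilde A^{12}+\widetilde A^{21}\big)\psi_{s_1}+\widetilde A^{22}\psi_{s_2}=0,\qquad \psi(s_1,0)=s_1,$$ $\psi(s_1+l,s_2)=\psi(s_1,s_2)+l$ and $\psi_{s_1}>0$. (If $A$ is symmetric, the first coefficient is $\widetilde A^{12}$.) (iii) *The transformation $\Phi$.* The formula $x=\frac{2\pi}{l}\psi(s_1,s_2)-\pi$, $y=s_2$ defines coordinates on $\mathcal N_0(\Gamma)$ in which $x$ is determined modulo $2\pi$. More precisely, there is a smooth map $\Psi=\Phi^{-1}:\mathbb R\times(-d_0,d_0)\to\mathbb R^2$ with invertible Jacobian matrix and with $\Psi\big(\frac{2\pi}{l}\psi(s)-\pi,\,s_2\big)=X(s)$,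 such that $\Psi(x,y)=\Psi(x',y')$ holds exactly when $y=y'$ and $x'-x\in2\pi\mathbb Z$. It maps both $\mathbb R\times(-d_0,d_0)$ and $$D_{d_0}=\{(x,y):-\pi\le x\le\pi,\ -d_0<y<d_0\}$$ onto $\mathcal N_0(\Gamma)$. (iv) *Normal form.* There are functions $\omega,a,b,c,m\in C^\infty(\mathbb R\times[-d_0,d_0])$, $2\pi$-periodic in $x$, with $m>0$, such that for $$\pounds v= y(\omega v_{xx}+v_{yy}+cv)+av_x+bv_y$$ one has $\pounds(u\circ\Psi)=m\cdot\big((Lu)\circ\Psi\big)$ at every point $p\in\mathbb R\times(-d_0,d_0)$ and for every $u$ that is $C^2$ near $\Psi(p)$. Consequently, for every function $F$ on $\mathcal N_0(\Gamma)$, the function $f=m\cdot(F\circ\Psi)$ is $2\pi$-periodic in $x$, and every $u\in C^2(\mathcal N_0(\Gamma))$ satisfies $$Lu=F\ \text{ in }\mathcal N_0(\Gamma)\iff \pounds(u\circ\Psi)=f\ \text{ on }D_{d_0}.$$ -/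

import Mathlib

open scoped ContDiff

noncomputable section

/-- The Euclidean plane. -/
abbrev E2 : Type := EuclideanSpace ℝ (Fin 2)

/-- The partial derivative of `u` with respect to the `i`-th coordinate. -/
def pd (i : Fin 2) (u : E2 → ℝ) (p : E2) : ℝ :=
  fderiv ℝ u p (EuclideanSpace.single i 1)

/-- The Jacobian matrix of a map of the plane: entry `(k, i)` is `∂X_k/∂s_i`. -/
def jacobian (X : E2 → E2) (s : E2) : Matrix (Fin 2) (Fin 2) ℝ :=
  Matrix.of fun k i => pd i (fun q => X q k) s

/-- The strip `ℝ × (-d, d)`. -/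
def strip (d : ℝ) : Set E2 := {p | |p 1| < d}

/-- The closed strip `ℝ × [-d, d]`. -/
def closedStrip (d : ℝ) : Set E2 := {p | |p 1| ≤ d}

/-- The domain `[-π, π] × (-d, d)`. -/
def periodCell (d : ℝ) : Set E2 := {p | p 0 ∈ Set.Icc (-Real.pi) Real.pi ∧ p 1 ∈ Set.Ioo (-d) d}

/-- `g` is a function on the closed strip `ℝ × [-d, d]`, smooth up to the boundary
and `2π`-periodic in `x`; that is, a smooth periodic function on the closure of
`[-π, π] × (-d, d)`. -/
def IsSmoothPeriodic (g : E2 → ℝ) (d : ℝ) : Prop :=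
  ContDiffOn ℝ ∞ g (closedStrip d) ∧
    ∀ x y : ℝ, |y| ≤ d → g !₂[x + 2 * Real.pi, y] = g !₂[x, y]

/-- `Γ` is a smooth (regular, simple) closed curve in the plane. -/
def IsSmoothClosedCurve (Γ : Set E2) : Prop :=
  ∃ (T : ℝ) (γ : ℝ → E2), 0 < T ∧ ContDiff ℝ ∞ γ ∧ Function.Periodic γ T ∧
    Set.InjOn γ (Set.Ico 0 T) ∧ (∀ t, deriv γ t ≠ 0) ∧ Set.range γ = Γ

/-- `ν` is an `l`-periodic smooth parametrization of the closed curve `Γ` by arc length,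
which runs through `Γ` once per period; so `l` is the length of `Γ`. -/
def IsArcLengthParam (ν : ℝ → E2) (l : ℝ) (Γ : Set E2) : Prop :=
  0 < l ∧ ContDiff ℝ ∞ ν ∧ Function.Periodic ν l ∧
    Set.InjOn ν (Set.Ico 0 l) ∧ (∀ s, ‖deriv ν s‖ = 1) ∧ Set.range ν = Γ

/-- The unit normal `∇φ / |∇φ|`, which points into `{φ > 0}`. -/
def unitNormal (φ : E2 → ℝ) (ξ : E2) : E2 := ‖gradient φ ξ‖⁻¹ • gradient φ ξ

/-- Normal coordinates: `(s₁, s₂) ↦ ν(s₁) + s₂ n(ν(s₁))`. -/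
def normalCoord (φ : E2 → ℝ) (ν : ℝ → E2) (s : E2) : E2 :=
  ν (s 0) + s 1 • unitNormal φ (ν (s 0))

/-- The tubular neighbourhood of half-width `d`. -/
def tube (φ : E2 → ℝ) (ν : ℝ → E2) (d : ℝ) : Set E2 := normalCoord φ ν '' strip d

/-- The principal coefficients `Ãⁱʲ = ∑ Aˡʳ ∂s_i/∂ξ_l ∂s_j/∂ξ_r` in the coordinates `s`
with `ξ = X s`, as a function of `s`; the matrix `(∂s_i/∂ξ_l)` is the inverse of the
Jacobian matrix of `X`. -/
def tildeA (X : E2 → E2) (A : Fin 2 → Fin 2 → E2 → ℝ) (i j : Fin 2) (s : E2) : ℝ :=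
  ∑ l, ∑ r, A l r (X s) * (jacobian X s)⁻¹ i l * (jacobian X s)⁻¹ j r

/-- `Lu = φ (∑ Aⁱʲ u_{ξ_i ξ_j} + C u) + ∑ Bˡ u_{ξ_l}`. -/
def opL (φ : E2 → ℝ) (A : Fin 2 → Fin 2 → E2 → ℝ) (B : Fin 2 → E2 → ℝ) (C : E2 → ℝ)
    (u : E2 → ℝ) (ξ : E2) : ℝ :=
  φ ξ * ((∑ i, ∑ j, A i j ξ * pd j (pd i u) ξ) + C ξ * u ξ) + ∑ l, B l ξ * pd l u ξ

/-- The normal form `y (w u_xx + u_yy + c u) + a u_x + b u_y`. -/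
def opNormalForm (w a b c : E2 → ℝ) (u : E2 → ℝ) (p : E2) : ℝ :=
  p 1 * (w p * pd 0 (pd 0 u) p + pd 1 (pd 1 u) p + c p * u p) + a p * pd 0 u p + b p * pd 1 u p

/-- `ψ` is a smooth solution, on the strip `ℝ × (-d, d)`, of the Cauchy problem
`Ã¹² ψ_{s₁} + Ã²² ψ_{s₂} = 0`, `ψ(s₁, 0) = s₁`, compatible with the period `l` of `s₁`.
As `A` is not assumed symmetric, `Ã¹²` stands for the entry of the symmetric part. -/
def SolvesCauchy (X : E2 → E2) (A : Fin 2 → Fin 2 → E2 → ℝ) (l d : ℝ) (ψ : E2 → ℝ) : Prop :=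
  ContDiffOn ℝ ∞ ψ (strip d) ∧
    (∀ s ∈ strip d, (tildeA X A 0 1 s + tildeA X A 1 0 s) / 2 * pd 0 ψ s
      + tildeA X A 1 1 s * pd 1 ψ s = 0) ∧
    (∀ s₁ : ℝ, ψ !₂[s₁, 0] = s₁) ∧
    ∀ s₁ s₂ : ℝ, |s₂| < d → ψ !₂[s₁ + l, s₂] = ψ !₂[s₁, s₂] + l

/-- `X` is a smooth parametrization of `N` by the strip `ℝ × (-d, d)`, a local diffeomorphism
that is `P`-periodic in the first variable and otherwise injective. Equivalently, its inverse
is a diffeomorphism of `N` onto the cylinder `(ℝ / Pℤ) × (-d, d)`. -/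
def IsPeriodicChart (X : E2 → E2) (P d : ℝ) (N : Set E2) : Prop :=
  ContDiffOn ℝ ∞ X (strip d) ∧ X '' strip d = N ∧
    (∀ s ∈ strip d, (jacobian X s).det ≠ 0) ∧
    ∀ s ∈ strip d, ∀ t ∈ strip d,
      X s = X t ↔ s 1 = t 1 ∧ ∃ k : ℤ, t 0 = s 0 + k * P

end

/-! In normal coordinates `X` the Jacobian matrix on the axis `s₂ = 0` has orthonormal columns, the
tangent and the normal of `Γ`. So `X` is a local diffeomorphism near the axis. Modulo the period the
axis is a compact circle on which `X` is injective, hence `X` is injective modulo the period on a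
whole strip. Since `φ ∘ X` vanishes on the axis with normal derivative `|∇φ| > 0`, Hadamard's lemma
gives `φ ∘ X = s₂ h` with `h > 0` on a thin strip (`exists_tubular`).

Ellipticity gives `Ã²² > 0`, so the Cauchy problem is the transport equation `g ψ₁ + ψ₂ = 0`, where
`g` is the symmetrized `Ã¹²` divided by `Ã²²`. After a cutoff in `s₂`, `g` is smooth, periodic and
bounded on the plane, and `α' = g(α, t)` has a global smooth flow. The flow increases with the
initial value and commutes with the translation by `l`. Its inverse in the initial value is `ψ`
(`exists_characteristic_coordinates`), and the flow itself, with an affine change of `x`, is the `θ`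
in `Ψ = X ∘ shear θ`.

The lines `x = const` are then characteristics, which makes the symmetrized mixed coefficient vanish
(`tildeA_comp_shear_mixed`). The chain rule (`opL_comp`) and division by `h Ã²²` leave the normal
form, with `m = 1 / (h Ã²²)`. -/

/-! ### Parametric integrals and difference quotients -/

open MeasureTheory Filter Set Topology in
theorem hasFDerivAt_integral_param {E F : Type} [NormedAddCommGroup E] [NormedSpace ℝ E]
    [ProperSpace E] [NormedAddCommGroup F] [NormedSpace ℝ F] [CompleteSpace F]
    {f : E × ℝ → F} (hf : ContDiff ℝ 1 f) (x : E) :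
    HasFDerivAt (fun x => ∫ t in (0:ℝ)..1, f (x, t))
      (∫ t in (0:ℝ)..1, (fderiv ℝ f (x, t)).comp (ContinuousLinearMap.inl ℝ E ℝ)) x := by
  have hc : Continuous f := hf.continuous
  have hd : Continuous fun p => (fderiv ℝ f p).comp (ContinuousLinearMap.inl ℝ E ℝ) :=
    (hf.continuous_fderiv one_ne_zero).clm_comp continuous_const
  obtain ⟨M, hM⟩ := ((isCompact_closedBall x 1).prod (isCompact_Icc (a := (0:ℝ)) (b := 1)))
    |>.exists_bound_of_continuousOn hd.continuousOn
  refine intervalIntegral.hasFDerivAt_integral_of_dominated_of_fderiv_le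
    (F := fun x t => f (x, t)) (bound := fun _ => M)
    (F' := fun x t => (fderiv ℝ f (x, t)).comp (ContinuousLinearMap.inl ℝ E ℝ))
    (Metric.ball_mem_nhds x one_pos) (Eventually.of_forall fun y => ?_) ?_ ?_ ?_ ?_ ?_
  · exact (hc.comp (by fun_prop : Continuous fun t : ℝ => (y, t))).aestronglyMeasurable
  · exact (hc.comp (by fun_prop : Continuous fun t : ℝ => (x, t))).intervalIntegrable _ _
  · exact (hd.comp (by fun_prop : Continuous fun t : ℝ => (x, t))).aestronglyMeasurable
  · refine Eventually.of_forall fun t ht y hy => hM (y, t) ⟨Metric.ball_subset_closedBall hy, ?_⟩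
    rw [uIoc_of_le zero_le_one] at ht
    exact ⟨ht.1.le, ht.2⟩
  · exact continuous_const.intervalIntegrable _ _
  · refine Eventually.of_forall fun t _ y _ => ?_
    have h1 : HasFDerivAt f (fderiv ℝ f (y, t)) (y, t) :=
      (hf.differentiable one_ne_zero _).hasFDerivAt
    exact h1.comp y (hasFDerivAt_prodMk_left y t)

/-- The derivative is again a parametric integral, but of a function with values in a space of
linear maps. The induction therefore runs over all target spaces `F` at once. -/
theorem contDiff_integral_param_nat {E : Type} [NormedAddCommGroup E] [NormedSpace ℝ E]
    [ProperSpace E] (n : ℕ) : ∀ {F : Type} [NormedAddCommGroup F] [NormedSpace ℝ F]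
    [CompleteSpace F] {f : E × ℝ → F}, ContDiff ℝ n f →
    ContDiff ℝ n (fun x => ∫ t in (0:ℝ)..1, f (x, t)) := by
  induction n with
  | zero =>
    intro F _ _ _ f hf
    have hf' : Continuous f := hf.continuous
    refine contDiff_zero.2 ?_
    exact intervalIntegral.continuous_parametric_intervalIntegral_of_continuous'
      (f := fun x t => f (x, t)) hf' 0 1
  | succ n ih =>
    intro F _ _ _ f hf
    have h1 : ContDiff ℝ 1 f := hf.of_le (by norm_cast; omega)
    have hd := hasFDerivAt_integral_param h1
    push_cast at hf ⊢
    rw [contDiff_succ_iff_fderiv] at hf ⊢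
    refine ⟨fun x => (hd x).differentiableAt, by simp, ?_⟩
    rw [funext fun x => (hd x).fderiv]
    exact ih (hf.2.2.clm_comp contDiff_const)

/-- A parametric integral of a smooth function is smooth. -/
theorem contDiff_integral_param {E F : Type} [NormedAddCommGroup E] [NormedSpace ℝ E]
    [ProperSpace E] [NormedAddCommGroup F] [NormedSpace ℝ F] [CompleteSpace F]
    {f : E × ℝ → F} {n : ℕ∞} (hf : ContDiff ℝ n f) :
    ContDiff ℝ n (fun x => ∫ t in (0:ℝ)..1, f (x, t)) :=
  contDiff_iff_forall_nat_le.2 fun m hm =>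
    contDiff_integral_param_nat m (hf.of_le (by exact_mod_cast hm))

/-- Hadamard's lemma: the difference quotient in the first variable is smooth. -/
theorem exists_smooth_slope {g : ℝ × ℝ → ℝ} (hg : ContDiff ℝ ∞ g) :
    ∃ Q : ℝ × ℝ × ℝ → ℝ, ContDiff ℝ ∞ Q ∧
      (∀ a b y, g (b, y) - g (a, y) = Q (a, b, y) * (b - a)) ∧
      (∀ a y, Q (a, a, y) = fderiv ℝ g (a, y) (1, 0)) ∧
      (∀ K : ℝ, (∀ p, |fderiv ℝ g p (1, 0)| ≤ K) → ∀ p, |Q p| ≤ K) ∧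
      ∀ P, (∀ a y, g (a, y + P) = g (a, y)) → ∀ a b y, Q (a, b, y + P) = Q (a, b, y) := by
  have hgx : ContDiff ℝ ∞ fun p => fderiv ℝ g p (1, 0) :=
    (contDiff_infty_iff_fderiv.1 hg).2.clm_apply contDiff_const
  refine ⟨fun p => ∫ t in (0:ℝ)..1, fderiv ℝ g (p.1 + t * (p.2.1 - p.1), p.2.2) (1, 0), ?_, ?_, ?_,
    ?_, ?_⟩
  · exact contDiff_integral_param (n := ⊤) (f := fun q : (ℝ × ℝ × ℝ) × ℝ =>
      fderiv ℝ g (q.1.1 + q.2 * (q.1.2.1 - q.1.1), q.1.2.2) (1, 0))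
      (hgx.comp (by fun_prop))
  · intro a b y
    have hd : ∀ t : ℝ, HasDerivAt (fun t : ℝ => g (a + t * (b - a), y))
        (fderiv ℝ g (a + t * (b - a), y) (1, 0) * (b - a)) t := by
      intro t
      have h1 := (hg.differentiable (by simp) (a + t * (b - a), y)).hasFDerivAt
      have h2 : HasDerivAt (fun t : ℝ => (a + t * (b - a), y)) ((b - a), 0) t :=
        (((hasDerivAt_id t).mul_const (b - a)).const_add a |>.congr_deriv (by simp)).prodMk
          (hasDerivAt_const t y)
      refine (h1.comp_hasDerivAt t h2).congr_deriv ?_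
      rw [show ((b - a, 0) : ℝ × ℝ) = (b - a) • (1, 0) by simp, map_smul, smul_eq_mul, mul_comm]
    have hc : Continuous fun t : ℝ => fderiv ℝ g (a + t * (b - a), y) (1, 0) :=
      hgx.continuous.comp (by fun_prop)
    have := intervalIntegral.integral_eq_sub_of_hasDerivAt (a := 0) (b := 1) (fun t _ => hd t)
      ((hc.mul continuous_const).intervalIntegrable _ _)
    rw [intervalIntegral.integral_mul_const] at this
    simpa using this.symm
  · intro a y
    simp
  · intro K hK p
    have := intervalIntegral.norm_integral_le_of_norm_le_const (a := 0) (b := 1) (C := K)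
      (f := fun t => fderiv ℝ g (p.1 + t * (p.2.1 - p.1), p.2.2) (1, 0)) (fun t _ => hK _)
    simpa using this
  · intro P hP a b y
    have h1 : (fun p : ℝ × ℝ => g (p + (0, P))) = g := by
      funext p
      obtain ⟨a, y⟩ := p
      simpa using hP a y
    have h2 : ∀ x, fderiv ℝ g (x, y + P) = fderiv ℝ g (x, y) := fun x => by
      have := fderiv_comp_add_right (𝕜 := ℝ) (f := g) (x := (x, y)) (0, P)
      rw [h1] at this
      simpa using this.symm
    simp only [h2]

/-! ### The flow of a scalar differential equation -/

/-- `α` solves the scalar equation `α' = g(α, t)` for all times. -/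
def IsSolution (g : ℝ × ℝ → ℝ) (α : ℝ → ℝ) : Prop :=
  ∀ t, HasDerivAt α (g (α t, t)) t

theorem IsSolution.continuous {g : ℝ × ℝ → ℝ} {α : ℝ → ℝ} (h : IsSolution g α) : Continuous α :=
  continuous_iff_continuousAt.2 fun t => (h t).continuousAt

/-- The difference `δ = β - α` solves the linear equation `δ' = Q δ`. This one formula yields
uniqueness, monotonicity in the initial value, the Lipschitz bound and the derivative of the flow.
-/
theorem IsSolution.sub_eq {g : ℝ × ℝ → ℝ} {Q : ℝ × ℝ × ℝ → ℝ} (hQ : Continuous Q)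
    (hgQ : ∀ a b y, g (b, y) - g (a, y) = Q (a, b, y) * (b - a)) {α β : ℝ → ℝ}
    (hα : IsSolution g α) (hβ : IsSolution g β) (y : ℝ) :
    β y - α y = (β 0 - α 0) * Real.exp (∫ t in (0:ℝ)..y, Q (α t, β t, t)) := by
  have hc : Continuous fun t => Q (α t, β t, t) :=
    hQ.comp (hα.continuous.prodMk (hβ.continuous.prodMk continuous_id))
  set I : ℝ → ℝ := fun y => ∫ t in (0:ℝ)..y, Q (α t, β t, t) with hI
  have hId : ∀ t, HasDerivAt I (Q (α t, β t, t)) t := fun t => hc.integral_hasStrictDerivAt 0 t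
    |>.hasDerivAt
  have hd : ∀ t, HasDerivAt (fun t => (β t - α t) * Real.exp (-I t)) 0 t := by
    intro t
    refine (((hβ t).sub (hα t)).mul (hId t).neg.exp).congr_deriv ?_
    rw [hgQ]
    simp only [Pi.sub_apply, Pi.neg_apply]
    ring
  have hcst := is_const_of_deriv_eq_zero (fun t => (hd t).differentiableAt)
    (fun t => (hd t).deriv) y 0
  have hI0 : I 0 = 0 := by simp [hI]
  simp only [hI0, neg_zero, Real.exp_zero, mul_one] at hcst
  rw [← hcst, mul_assoc, ← Real.exp_add, neg_add_cancel, Real.exp_zero,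
    mul_one]

theorem IsSolution.eq {g : ℝ × ℝ → ℝ} (hg : ContDiff ℝ ∞ g) {α β : ℝ → ℝ}
    (hα : IsSolution g α) (hβ : IsSolution g β) (h0 : α 0 = β 0) : α = β := by
  obtain ⟨Q, hQ, hgQ, -⟩ := exists_smooth_slope hg
  funext y
  have := hα.sub_eq hQ.continuous hgQ hβ y
  rw [h0, sub_self, zero_mul, sub_eq_zero] at this
  exact this.symm

-- The bounds on `g` and `∂₁g` are global, so Picard–Lindelöf applies on all of `[-2, 2]`. For `|t|
-- ≥ 1` the right-hand side is zero, and the solution continues as a constant.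
open Set in
theorem exists_isSolution {g : ℝ × ℝ → ℝ} (hg : ContDiff ℝ ∞ g)
    (h0 : ∀ x y, 1 ≤ |y| → g (x, y) = 0) {M K : ℝ} (hM : ∀ p, |g p| ≤ M)
    (hK : ∀ p, |fderiv ℝ g p (1, 0)| ≤ K) (x : ℝ) :
    ∃ α : ℝ → ℝ, α 0 = x ∧ IsSolution g α := by
  obtain ⟨Q, -, hgQ, -, hQK, -⟩ := exists_smooth_slope hg
  have hM0 : 0 ≤ M := (abs_nonneg _).trans (hM 0)
  have hK0 : 0 ≤ K := (abs_nonneg _).trans (hK 0)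
  have hPL : IsPicardLindelof (fun t x => g (x, t)) (tmin := -2) (tmax := 2)
      ⟨0, by norm_num⟩ x (2 * M.toNNReal) 0 M.toNNReal K.toNNReal := by
    refine ⟨fun t _ => ?_, fun z _ => ?_, fun t _ z _ => ?_, ?_⟩
    · refine LipschitzWith.lipschitzOnWith (LipschitzWith.of_dist_le_mul fun a b => ?_)
      rw [dist_comm a b, Real.dist_eq, Real.dist_eq, abs_sub_comm, hgQ a b t, abs_mul,
        Real.coe_toNNReal _ hK0]
      exact mul_le_mul_of_nonneg_right (hQK K hK _) (abs_nonneg _)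
    · exact (hg.continuous.comp (by fun_prop)).continuousOn
    · rw [Real.coe_toNNReal _ hM0]; exact hM _
    · simp [hM0, mul_comm]
  obtain ⟨β, hβ0, hβ⟩ := hPL.exists_eq_forall_mem_Icc_hasDerivWithinAt₀
  simp only at hβ0 hβ
  have hβc : ContinuousOn β (Icc (-2) 2) := fun t ht => (hβ t ht).continuousWithinAt
  have h22 : (-2 : ℝ) ≤ 2 := by norm_num
  have hγc : Continuous fun t => g (IccExtend h22 ((Icc (-2) 2).domRestrict β) t, t) :=
    hg.continuous.comp ((hβc.domRestrict.Icc_extend').prodMk continuous_id)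
  -- Outside `[-2, 2]` the extension freezes `β` at its end values. This does not matter there,
  -- since `g` vanishes whatever its first argument is.
  set α : ℝ → ℝ := fun y => x + ∫ t in (0:ℝ)..y, g (IccExtend h22 ((Icc (-2) 2).domRestrict β) t, t)
    with hα
  have hαd : ∀ t, HasDerivAt α (g (IccExtend h22 ((Icc (-2) 2).domRestrict β) t, t)) t := fun t =>
    (hγc.integral_hasStrictDerivAt 0 t).hasDerivAt.const_add x
  have hα0 : α 0 = x := by simp [hα]
  have hext : ∀ t ∈ Icc (-2:ℝ) 2, IccExtend h22 ((Icc (-2) 2).domRestrict β) t = β t := fun t ht => by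
    rw [IccExtend_of_mem _ _ ht, domRestrict_apply]
  have hαβ : ∀ t ∈ Icc (-2:ℝ) 2, α t = β t := by
    intro t ht
    have := (convex_Icc (-2:ℝ) 2).norm_image_sub_le_of_norm_hasDerivWithin_le (C := 0)
      (f := fun t => α t - β t) (f' := fun _ => 0) (x := 0) (y := t)
      (fun s hs => ((hαd s).hasDerivWithinAt.sub (hβ s hs)).congr_deriv
        (by rw [hext s hs, sub_self])) (by simp) (by norm_num) ht
    simp only [hα0, hβ0, sub_self, zero_mul, norm_le_zero_iff, sub_zero] at this
    linarith
  refine ⟨α, hα0, fun t => (hαd t).congr_deriv ?_⟩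
  by_cases ht : t ∈ Icc (-2:ℝ) 2
  · rw [hext t ht, hαβ t ht]
  · have ht1 : 1 ≤ |t| := by
      by_contra hlt
      have := abs_le.1 (not_le.1 hlt).le
      exact ht ⟨by linarith [this.1], by linarith [this.2]⟩
    rw [h0 _ _ ht1, h0 _ _ ht1]

/-- The flow of `α' = g(α, t)`, as a function of the value at time `0` and the time. -/
structure IsFlow (g : ℝ × ℝ → ℝ) (Θ : ℝ × ℝ → ℝ) : Prop where
  zero : ∀ x, Θ (x, 0) = x
  sol : ∀ x, IsSolution g fun t => Θ (x, t)

theorem exists_isFlow {g : ℝ × ℝ → ℝ} (hg : ContDiff ℝ ∞ g)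
    (h0 : ∀ x y, 1 ≤ |y| → g (x, y) = 0) {M K : ℝ} (hM : ∀ p, |g p| ≤ M)
    (hK : ∀ p, |fderiv ℝ g p (1, 0)| ≤ K) : ∃ Θ, IsFlow g Θ := by
  choose Θ hΘ0 hΘ using exists_isSolution hg h0 hM hK
  exact ⟨fun p => Θ p.1 p.2, hΘ0, hΘ⟩

/-- Joint continuity follows from continuity in time and a Lipschitz bound in the initial value that
is locally uniform in time. -/
theorem IsFlow.continuous {g Θ : ℝ × ℝ → ℝ} (hΘ : IsFlow g Θ) (hg : ContDiff ℝ ∞ g) {K : ℝ}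
    (hK : ∀ p, |fderiv ℝ g p (1, 0)| ≤ K) : Continuous Θ := by
  obtain ⟨Q, hQ, hgQ, -, hQK, -⟩ := exists_smooth_slope hg
  have hlip : ∀ a b y, |Θ (b, y) - Θ (a, y)| ≤ |b - a| * Real.exp (K * |y|) := by
    intro a b y
    have := (hΘ.sol a).sub_eq hQ.continuous hgQ (hΘ.sol b) y
    simp only [hΘ.zero] at this
    rw [this, abs_mul, Real.abs_exp]
    gcongr
    have := intervalIntegral.norm_integral_le_of_norm_le_const (a := 0) (b := y) (C := K)
      (f := fun t => Q (Θ (a, t), Θ (b, t), t)) (fun t _ => hQK K hK _)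
    rw [sub_zero] at this
    exact (le_abs_self _).trans this
  refine continuous_iff_continuousAt.2 fun ⟨a, y₀⟩ => ?_
  have h1 : Filter.Tendsto (fun p : ℝ × ℝ => Θ (a, p.2)) (nhds (a, y₀)) (nhds (Θ (a, y₀))) :=
    (((hΘ.sol a).continuous.comp continuous_snd).tendsto (a, y₀))
  have h2 : Filter.Tendsto (fun p : ℝ × ℝ => Θ p - Θ (a, p.2)) (nhds (a, y₀)) (nhds 0) := by
    refine squeeze_zero_norm (fun p => hlip a p.1 p.2) ?_
    have : Continuous fun p : ℝ × ℝ => |p.1 - a| * Real.exp (K * |p.2|) := by fun_prop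
    simpa using this.tendsto (a, y₀)
  simpa [ContinuousAt] using h2.add h1

theorem IsFlow.hasDerivAt_fst {g Θ : ℝ × ℝ → ℝ} (hΘ : IsFlow g Θ) (hg : ContDiff ℝ ∞ g)
    (hc : Continuous Θ) (x y : ℝ) :
    HasDerivAt (fun x => Θ (x, y))
      (Real.exp (y * ∫ t in (0:ℝ)..1, fderiv ℝ g (Θ (x, y * t), y * t) (1, 0))) x := by
  obtain ⟨Q, hQ, hgQ, hQd, -⟩ := exists_smooth_slope hg
  have key : ∀ b, Θ (b, y) - Θ (x, y) =
      (b - x) * Real.exp (∫ t in (0:ℝ)..y, Q (Θ (x, t), Θ (b, t), t)) := by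
    intro b
    have := (hΘ.sol x).sub_eq hQ.continuous hgQ (hΘ.sol b) y
    simpa only [hΘ.zero] using this
  have hE : Continuous fun b => Real.exp (∫ t in (0:ℝ)..y, Q (Θ (x, t), Θ (b, t), t)) := by
    refine Real.continuous_exp.comp ?_
    exact intervalIntegral.continuous_parametric_intervalIntegral_of_continuous'
      (f := fun b t => Q (Θ (x, t), Θ (b, t), t))
      (hQ.continuous.comp (by fun_prop)) 0 y
  -- Rescaling to `[0, 1]` moves the variable endpoint into the integrand, the shape needed by
  -- `contDiff_integral_param`.
  have hval : (∫ t in (0:ℝ)..y, Q (Θ (x, t), Θ (x, t), t)) =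
      y * ∫ t in (0:ℝ)..1, fderiv ℝ g (Θ (x, y * t), y * t) (1, 0) := by
    simp only [hQd]
    have := intervalIntegral.smul_integral_comp_mul_left (a := 0) (b := 1)
      (fun t => fderiv ℝ g (Θ (x, t), t) (1, 0)) y
    simpa using this.symm
  rw [← hval, hasDerivAt_iff_tendsto_slope]
  refine ((hE.tendsto x).mono_left nhdsWithin_le_nhds).congr' ?_
  filter_upwards [self_mem_nhdsWithin] with b hb
  rw [slope_def_field, key, mul_div_cancel_left₀ _ (sub_ne_zero.2 hb)]

theorem IsFlow.hasFDerivAt {g Θ : ℝ × ℝ → ℝ} (hΘ : IsFlow g Θ) (hg : ContDiff ℝ ∞ g)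
    (hc : Continuous Θ) (p : ℝ × ℝ) :
    HasFDerivAt Θ
      ((Real.exp (p.2 * ∫ t in (0:ℝ)..1, fderiv ℝ g (Θ (p.1, p.2 * t), p.2 * t) (1, 0))) •
        ContinuousLinearMap.fst ℝ ℝ ℝ + g (Θ p, p.2) • ContinuousLinearMap.snd ℝ ℝ ℝ) p := by
  have hgx : Continuous fun p => fderiv ℝ g p (1, 0) :=
    (contDiff_infty_iff_fderiv.1 hg).2.continuous.clm_apply continuous_const
  have c1 : Continuous fun p : ℝ × ℝ =>
      Real.exp (p.2 * ∫ t in (0:ℝ)..1, fderiv ℝ g (Θ (p.1, p.2 * t), p.2 * t) (1, 0)) := by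
    refine Real.continuous_exp.comp (continuous_snd.mul ?_)
    exact intervalIntegral.continuous_parametric_intervalIntegral_of_continuous'
      (f := fun (p : ℝ × ℝ) t => fderiv ℝ g (Θ (p.1, p.2 * t), p.2 * t) (1, 0))
      (hgx.comp (by fun_prop)) 0 1
  have c2 : Continuous fun p : ℝ × ℝ => g (Θ p, p.2) := hg.continuous.comp (by fun_prop)
  have := hasStrictFDerivAt_uncurry_coprod (𝕜 := ℝ) (u := p) (f := fun x y => Θ (x, y))
    (f₁ := fun x y => ContinuousLinearMap.toSpanSingleton ℝ (Real.exp (y * ∫ t in (0:ℝ)..1,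
      fderiv ℝ g (Θ (x, y * t), y * t) (1, 0))))
    (f₂ := fun x y => ContinuousLinearMap.toSpanSingleton ℝ (g (Θ (x, y), y)))
    (Filter.Eventually.of_forall fun v => (hΘ.hasDerivAt_fst hg hc v.1 v.2).hasFDerivAt)
    (Filter.Eventually.of_forall fun v => (hΘ.sol v.1 v.2).hasFDerivAt)
    (((ContinuousLinearMap.toSpanSingletonCLE (𝕜 := ℝ) (E := ℝ)).continuous.comp c1).continuousAt)
    (((ContinuousLinearMap.toSpanSingletonCLE (𝕜 := ℝ) (E := ℝ)).continuous.comp c2).continuousAt)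
  refine this.hasFDerivAt.congr_fderiv ?_
  ext <;> simp [Function.HasUncurry.uncurry]

/-- Bootstrapping: both partial derivatives are smooth expressions in `Θ` and an integral along `Θ`,
so if `Θ` is `C^n` then it is `C^(n+1)`. -/
theorem IsFlow.contDiff {g Θ : ℝ × ℝ → ℝ} (hΘ : IsFlow g Θ) (hg : ContDiff ℝ ∞ g)
    (hc : Continuous Θ) : ContDiff ℝ ∞ Θ := by
  have hgx : ContDiff ℝ ∞ fun p => fderiv ℝ g p (1, 0) :=
    (contDiff_infty_iff_fderiv.1 hg).2.clm_apply contDiff_const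
  refine contDiff_infty.2 fun n => ?_
  induction n with
  | zero => exact contDiff_zero.2 hc
  | succ n ih =>
    push_cast
    rw [contDiff_succ_iff_fderiv]
    refine ⟨fun p => (hΘ.hasFDerivAt hg hc p).differentiableAt, by simp, ?_⟩
    rw [funext fun p => (hΘ.hasFDerivAt hg hc p).fderiv]
    have hgn := hg.of_le (m := n) (by exact_mod_cast le_top)
    have hgxn := hgx.of_le (m := n) (by exact_mod_cast le_top)
    have hint : ContDiff ℝ n fun p : ℝ × ℝ =>
        ∫ t in (0:ℝ)..1, fderiv ℝ g (Θ (p.1, p.2 * t), p.2 * t) (1, 0) :=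
      contDiff_integral_param (n := n) (f := fun q : (ℝ × ℝ) × ℝ =>
        fderiv ℝ g (Θ (q.1.1, q.1.2 * q.2), q.1.2 * q.2) (1, 0))
        (hgxn.comp (by fun_prop))
    have hgc : ContDiff ℝ n fun p : ℝ × ℝ => g (Θ p, p.2) := hgn.comp (by fun_prop)
    fun_prop

theorem IsFlow.add_period {g Θ : ℝ × ℝ → ℝ} (hΘ : IsFlow g Θ) (hg : ContDiff ℝ ∞ g) {l : ℝ}
    (hl : ∀ x y, g (x + l, y) = g (x, y)) (x y : ℝ) : Θ (x + l, y) = Θ (x, y) + l := by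
  have h : IsSolution g fun t => Θ (x, t) + l := fun t => by
    have := (hΘ.sol x t).add_const l
    rwa [← hl] at this
  exact congrFun ((hΘ.sol (x + l)).eq hg h (by simp [hΘ.zero])) y

theorem IsFlow.strictMono {g Θ : ℝ × ℝ → ℝ} (hΘ : IsFlow g Θ) (hg : ContDiff ℝ ∞ g) (y : ℝ) :
    StrictMono fun x => Θ (x, y) := by
  obtain ⟨Q, hQ, hgQ, -⟩ := exists_smooth_slope hg
  intro a b hab
  have := (hΘ.sol a).sub_eq hQ.continuous hgQ (hΘ.sol b) y
  simp only [hΘ.zero] at this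
  have h2 := mul_pos (sub_pos.2 hab) (Real.exp_pos (∫ t in (0:ℝ)..y, Q (Θ (a, t), Θ (b, t), t)))
  simp only
  linarith

/-! ### Inverse functions and calculus in the plane -/

-- Near each point the given inverse agrees with the local inverse from the inverse function
-- theorem, because `f'` is also a left inverse.
open Filter Topology in
theorem contDiff_of_inverse {E F : Type*} [NormedAddCommGroup E] [NormedSpace ℝ E]
    [CompleteSpace E] [NormedAddCommGroup F] [NormedSpace ℝ F] [CompleteSpace F] {f : E → F}
    {f' : F → E} (hf : ContDiff ℝ ∞ f) (hd : ∀ a, ∃ e : E ≃L[ℝ] F, HasFDerivAt f (e : E →L[ℝ] F) a)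
    (hl : ∀ a, f' (f a) = a) (hr : ∀ b, f (f' b) = b) : ContDiff ℝ ∞ f' := by
  refine contDiff_iff_contDiffAt.2 fun b => ?_
  obtain ⟨e, he⟩ := hd (f' b)
  have h0 : (∞ : WithTop ℕ∞) ≠ 0 := by simp
  have h1 := hf.contDiffAt.to_localInverse he h0
  rw [hr] at h1
  refine h1.congr_of_eventuallyEq ?_
  have h2 := (hf.contDiffAt.hasStrictFDerivAt' he h0).eventually_right_inverse
  rw [hr] at h2
  filter_upwards [h2] with z hz
  have := hl (hf.contDiffAt.localInverse he h0 z)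
  rw [← this]
  exact congrArg f' hz.symm

namespace E2

theorem eta (p : E2) : !₂[p 0, p 1] = p := by
  ext i; fin_cases i <;> simp

theorem eq_single (v : E2) :
    v = v 0 • EuclideanSpace.single 0 1 + v 1 • EuclideanSpace.single 1 1 := by
  ext i; fin_cases i <;> simp

theorem contDiff_mk {E : Type*} [NormedAddCommGroup E] [NormedSpace ℝ E] {n : WithTop ℕ∞}
    {f g : E → ℝ} (hf : ContDiff ℝ n f) (hg : ContDiff ℝ n g) :
    ContDiff ℝ n fun x => (!₂[f x, g x] : E2) := by
  refine (contDiff_piLp 2).2 fun i => ?_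
  fin_cases i
  · exact hf
  · exact hg

theorem continuous_mk {E : Type*} [TopologicalSpace E]
    {f g : E → ℝ} (hf : Continuous f) (hg : Continuous g) :
    Continuous fun x => (!₂[f x, g x] : E2) := by
  refine (PiLp.continuous_toLp 2 _).comp (continuous_pi fun i => ?_)
  fin_cases i
  · exact hf
  · exact hg

theorem contDiff_apply {n : WithTop ℕ∞} (i : Fin 2) : ContDiff ℝ n fun p : E2 => p i :=
  (EuclideanSpace.proj (𝕜 := ℝ) i).contDiff

theorem continuous_apply (i : Fin 2) : Continuous fun p : E2 => p i :=
  (EuclideanSpace.proj (𝕜 := ℝ) i).continuous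

end E2

theorem fderiv_eq_sum_pd (u : E2 → ℝ) (p v : E2) :
    fderiv ℝ u p v = pd 0 u p * v 0 + pd 1 u p * v 1 := by
  conv_lhs => rw [E2.eq_single v]
  simp [pd, mul_comm]

theorem pd_congr {u v : E2 → ℝ} {p : E2} (h : u =ᶠ[nhds p] v) (i : Fin 2) : pd i u p = pd i v p := by
  rw [pd, pd, h.fderiv_eq]

theorem pd_add {u v : E2 → ℝ} {p : E2} (hu : DifferentiableAt ℝ u p) (hv : DifferentiableAt ℝ v p)
    (i : Fin 2) : pd i (fun x => u x + v x) p = pd i u p + pd i v p := by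
  simp only [pd]
  rw [fderiv_fun_add hu hv]; rfl

theorem pd_mul {u v : E2 → ℝ} {p : E2} (hu : DifferentiableAt ℝ u p) (hv : DifferentiableAt ℝ v p)
    (i : Fin 2) : pd i (fun x => u x * v x) p = u p * pd i v p + pd i u p * v p := by
  simp only [pd]
  rw [fderiv_fun_mul hu hv]
  simp [mul_comm]

theorem pd_comm {u : E2 → ℝ} {p : E2} (hu : ContDiffAt ℝ 2 u p) (i j : Fin 2) :
    pd i (pd j u) p = pd j (pd i u) p := by
  have hd : DifferentiableAt ℝ (fderiv ℝ u) p :=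
    (hu.fderiv_right (m := 1) (by norm_num)).differentiableAt one_ne_zero
  have h : ∀ i j, pd i (pd j u) p =
      fderiv ℝ (fderiv ℝ u) p (EuclideanSpace.single i 1) (EuclideanSpace.single j 1) := by
    intro i j
    simp only [pd]
    rw [show pd j u =
      fun q => (fderiv ℝ u q) ((fun _ => EuclideanSpace.single j 1) q) from rfl,
      fderiv_clm_apply hd (differentiableAt_const _)]
    simp
  rw [h, h]
  exact hu.isSymmSndFDerivAt (by simp) _ _

theorem contDiffAt_pd {u : E2 → ℝ} {p : E2} {m n : WithTop ℕ∞} (hu : ContDiffAt ℝ n u p)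
    (hmn : m + 1 ≤ n) (i : Fin 2) : ContDiffAt ℝ m (pd i u) p :=
  (hu.fderiv_right hmn).clm_apply contDiffAt_const

theorem contDiffOn_pd {u : E2 → ℝ} {S : Set E2} (hS : IsOpen S) (hu : ContDiffOn ℝ ∞ u S)
    (i : Fin 2) : ContDiffOn ℝ ∞ (pd i u) S := fun _ hp =>
  (contDiffAt_pd (hu.contDiffAt (hS.mem_nhds hp)) (by simp) i).contDiffWithinAt

theorem contDiffOn_jacobian {X : E2 → E2} {S : Set E2} (hS : IsOpen S) (hX : ContDiffOn ℝ ∞ X S)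
    (i j : Fin 2) : ContDiffOn ℝ ∞ (fun s => jacobian X s i j) S :=
  contDiffOn_pd hS ((E2.contDiff_apply i).comp_contDiffOn hX) j

theorem jacobian_apply {X : E2 → E2} {s : E2} (hX : DifferentiableAt ℝ X s) (k i : Fin 2) :
    jacobian X s k i = fderiv ℝ X s (EuclideanSpace.single i 1) k := by
  have h := (EuclideanSpace.proj (𝕜 := ℝ) (ι := Fin 2) k).hasFDerivAt.comp s
    hX.hasFDerivAt
  change fderiv ℝ (fun q => X q k) s _ = _
  rw [show (fun q => X q k) = (EuclideanSpace.proj (𝕜 := ℝ) k) ∘ X from rfl, h.fderiv]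
  rfl

theorem pd_comp {u : E2 → ℝ} {X : E2 → E2} {s : E2} (hu : DifferentiableAt ℝ u (X s))
    (hX : DifferentiableAt ℝ X s) (i : Fin 2) :
    pd i (u ∘ X) s = pd 0 u (X s) * jacobian X s 0 i + pd 1 u (X s) * jacobian X s 1 i := by
  rw [jacobian_apply hX, jacobian_apply hX, ← fderiv_eq_sum_pd, pd, fderiv_comp s hu hX]
  rfl

theorem jacobian_comp {X K : E2 → E2} {s : E2} (hX : DifferentiableAt ℝ X (K s))
    (hK : DifferentiableAt ℝ K s) : jacobian (X ∘ K) s = jacobian X (K s) * jacobian K s := by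
  ext i j
  have h : DifferentiableAt ℝ (fun q => X q i) (K s) :=
    ((EuclideanSpace.proj (𝕜 := ℝ) i).differentiableAt).comp (K s) hX
  rw [Matrix.mul_apply, Fin.sum_univ_two]
  exact pd_comp h hK j

theorem fderiv_apply_eq {X : E2 → E2} {s : E2} (hX : DifferentiableAt ℝ X s) (v : E2) :
    fderiv ℝ X s v = WithLp.toLp 2 ((jacobian X s).mulVec (WithLp.ofLp v)) := by
  conv_lhs => rw [E2.eq_single v]
  ext k
  simp [jacobian_apply hX, Matrix.mulVec, dotProduct, Fin.sum_univ_two, mul_comm]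

theorem exists_equiv_of_det_ne_zero {X : E2 → E2} {s : E2} (hX : DifferentiableAt ℝ X s)
    (hdet : (jacobian X s).det ≠ 0) : ∃ e : E2 ≃L[ℝ] E2, HasFDerivAt X (e : E2 →L[ℝ] E2) s := by
  have hinj : Function.Injective (fderiv ℝ X s : E2 →ₗ[ℝ] E2) := by
    rw [← LinearMap.ker_eq_bot, LinearMap.ker_eq_bot']
    intro v hv
    have h1 : fderiv ℝ X s v = 0 := hv
    rw [fderiv_apply_eq hX] at h1
    have h2 : (jacobian X s).mulVec (WithLp.ofLp v) = 0 := congrArg WithLp.ofLp h1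
    have h3 := Matrix.eq_zero_of_mulVec_eq_zero hdet h2
    exact congrArg (WithLp.toLp 2) h3
  refine ⟨(LinearEquiv.ofInjectiveEndo (fderiv ℝ X s : E2 →ₗ[ℝ] E2) hinj).toContinuousLinearEquiv,
    hX.hasFDerivAt.congr_fderiv ?_⟩
  ext v
  rfl

theorem isOpen_image_of_det_ne_zero {X : E2 → E2} {S : Set E2} (hS : IsOpen S)
    (hX : ContDiffOn ℝ ∞ X S) (hdet : ∀ s ∈ S, (jacobian X s).det ≠ 0) : IsOpen (X '' S) := by
  rw [isOpen_iff_mem_nhds]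
  rintro _ ⟨s, hs, rfl⟩
  have hc := hX.contDiffAt (hS.mem_nhds hs)
  obtain ⟨e, he⟩ := exists_equiv_of_det_ne_zero (hc.differentiableAt (by simp)) (hdet s hs)
  have := (hc.hasStrictFDerivAt' he (by simp)).map_nhds_eq_of_equiv
  rw [← this]
  exact Filter.image_mem_map (hS.mem_nhds hs)

theorem exists_injOn_of_det_ne_zero {X : E2 → E2} {s : E2} (hX : ContDiffAt ℝ ∞ X s)
    (hdet : (jacobian X s).det ≠ 0) : ∃ U ∈ nhds s, Set.InjOn X U := by
  obtain ⟨e, he⟩ := exists_equiv_of_det_ne_zero (hX.differentiableAt (by simp)) hdet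
  have h := hX.hasStrictFDerivAt' he (by simp)
  refine ⟨(h.toOpenPartialHomeomorph X).source,
    (h.toOpenPartialHomeomorph X).open_source.mem_nhds h.mem_toOpenPartialHomeomorph_source, ?_⟩
  exact (h.toOpenPartialHomeomorph X).injOn

/-! ### Strips, periodic functions and extension -/

theorem isOpen_strip (d : ℝ) : IsOpen (strip d) :=
  isOpen_lt (E2.continuous_apply 1).abs continuous_const

theorem closedStrip_subset_strip {d e : ℝ} (h : d < e) : closedStrip d ⊆ strip e :=
  fun _ hp => lt_of_le_of_lt hp h

theorem strip_subset_closedStrip (d : ℝ) : strip d ⊆ closedStrip d := fun _ hp =>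
  (show |_| < d from hp).le

theorem strip_mono {d e : ℝ} (h : d ≤ e) : strip d ⊆ strip e := fun _ hp => lt_of_lt_of_le hp h

theorem mk_mem_strip {x y d : ℝ} : (!₂[x, y] : E2) ∈ strip d ↔ |y| < d := Iff.rfl

/-- Each real number is congruent modulo `l` to an element of `[0, l)`. -/
theorem exists_add_int_mul_mem_Ico {l : ℝ} (hl : 0 < l) (x : ℝ) :
    ∃ k : ℤ, x + k * l ∈ Set.Ico 0 l := by
  refine ⟨-⌊x / l⌋, ?_⟩
  have h1 := Int.floor_le (x / l)
  have h2 := Int.lt_floor_add_one (x / l)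
  rw [le_div_iff₀ hl] at h1
  rw [div_lt_iff₀ hl] at h2
  push_cast
  constructor <;> nlinarith

/-- `f` has period `P` in the first variable. -/
def PeriodicFst {α : Type*} (P : ℝ) (f : E2 → α) : Prop := ∀ x y, f !₂[x + P, y] = f !₂[x, y]

theorem PeriodicFst.int {α : Type*} {P : ℝ} {f : E2 → α} (h : PeriodicFst P f) (k : ℤ) (x y : ℝ) :
    f !₂[x + k * P, y] = f !₂[x, y] := by
  have : Function.Periodic (fun x => f !₂[x, y]) P := fun x => h x y
  exact this.int_mul k x

theorem PeriodicFst.fderiv {P : ℝ} {F : Type*} [NormedAddCommGroup F] [NormedSpace ℝ F]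
    {f : E2 → F} (h : PeriodicFst P f) : PeriodicFst P (fderiv ℝ f) := by
  intro x y
  have h1 : (fun p : E2 => f (p + !₂[P, 0])) = f := by
    funext p
    rw [← E2.eta p]
    convert h (p 0) (p 1) using 2
    ext i; fin_cases i <;> simp
  have h2 := fderiv_comp_add_right (𝕜 := ℝ) (f := f) (x := !₂[x, y]) !₂[P, 0]
  rw [h1] at h2
  rw [h2]
  congr 1
  ext i; fin_cases i <;> simp

theorem PeriodicFst.pd {P : ℝ} {f : E2 → ℝ} (h : PeriodicFst P f) (i : Fin 2) :
    PeriodicFst P (pd i f) := fun x y => by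
  rw [_root_.pd, _root_.pd, h.fderiv]

theorem PeriodicFst.comp {α β : Type*} {P : ℝ} {f : E2 → α} (h : PeriodicFst P f) (g : α → β) :
    PeriodicFst P fun p => g (f p) := fun x y => congrArg g (h x y)

theorem PeriodicFst.jacobian {P : ℝ} {X : E2 → E2} (h : PeriodicFst P X) :
    PeriodicFst P (jacobian X) := fun x y => by
  ext k i
  exact (h.comp fun q => q k).pd i x y

/-- A periodic open condition that holds on the axis holds on a strip. -/
theorem exists_closedStrip_subset {P : ℝ} (hP : 0 < P) {U : Set E2}
    (hU : ∀ x, U ∈ nhds (!₂[x, 0] : E2)) (hper : PeriodicFst P (· ∈ U)) :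
    ∃ d > 0, closedStrip d ⊆ U := by
  have hx : ∀ x : ℝ, ∃ V ∈ nhds x, ∃ d > 0, ∀ x' ∈ V, ∀ y, |y| ≤ d → (!₂[x', y] : E2) ∈ U := by
    intro x
    have hc : Continuous fun q : ℝ × ℝ => (!₂[q.1, q.2] : E2) :=
      E2.continuous_mk continuous_fst continuous_snd
    have := (hc.continuousAt (x := (x, 0))).preimage_mem_nhds (hU x)
    obtain ⟨V, hV, W, hW, hVW⟩ := mem_nhds_prod_iff.1 this
    obtain ⟨d, hd, hdW⟩ := Metric.nhds_basis_closedBall.mem_iff.1 hW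
    exact ⟨V, hV, d, hd, fun x' hx' y hy =>
      hVW (show (x', y) ∈ V ×ˢ W from ⟨hx', hdW (by simpa using hy)⟩)⟩
  have key : ∃ d > 0, ∀ x ∈ Set.Icc 0 P, ∀ y, |y| ≤ d → (!₂[x, y] : E2) ∈ U := by
    refine (isCompact_Icc (a := 0) (b := P)).induction_on
      (p := fun s => ∃ d > 0, ∀ x ∈ s, ∀ y, |y| ≤ d → (!₂[x, y] : E2) ∈ U) ?_ ?_ ?_ ?_
    · exact ⟨1, one_pos, by simp⟩
    · rintro s t hst ⟨d, hd, h⟩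
      exact ⟨d, hd, fun x hx => h x (hst hx)⟩
    · rintro s t ⟨d, hd, h⟩ ⟨e, he, h'⟩
      refine ⟨min d e, lt_min hd he, fun x hx y hy => ?_⟩
      rcases hx with hx | hx
      · exact h x hx y (hy.trans (min_le_left _ _))
      · exact h' x hx y (hy.trans (min_le_right _ _))
    · intro x _
      obtain ⟨V, hV, d, hd, h⟩ := hx x
      exact ⟨V, mem_nhdsWithin_of_mem_nhds hV, d, hd, h⟩
  obtain ⟨d, hd, h⟩ := key
  refine ⟨d, hd, fun p hp => ?_⟩
  obtain ⟨k, hk⟩ := exists_add_int_mul_mem_Ico hP (p 0)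
  have h1 := h _ ⟨hk.1, hk.2.le⟩ (p 1) hp
  have h2 := hper.int k (p 0) (p 1)
  simp only [eq_iff_iff] at h2
  rw [h2, E2.eta] at h1
  exact h1

/-- A smooth function on a strip agrees with a global smooth function near a smaller strip. -/
theorem exists_extension {f : E2 → ℝ} {d e : ℝ} (hd : 0 < d) (hde : d < e)
    (hf : ContDiffOn ℝ ∞ f (strip e)) :
    ∃ f' : E2 → ℝ, ContDiff ℝ ∞ f' ∧ (∀ p ∈ closedStrip d, f' p = f p) ∧
      (∀ p, e ≤ |p 1| → f' p = 0) ∧ ∀ P, (∀ x y, |y| < e → f !₂[x + P, y] = f !₂[x, y]) →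
        PeriodicFst P f' := by
  -- The cutoff depends on the second coordinate only, so it preserves periods in the first. It
  -- vanishes from `(d + e) / 2` on, hence in a neighbourhood of `|y| ≥ e`, where nothing is known
  -- about `f`.
  let χ : ContDiffBump (0 : ℝ) := ⟨d, (d + e) / 2, hd, by linarith⟩
  have hχ : ∀ p : E2, (d + e) / 2 ≤ |p 1| → χ (p 1) = 0 := fun p hp =>
    χ.zero_of_le_dist (by simpa [Real.dist_eq] using hp)
  refine ⟨fun p => χ (p 1) * f p, ?_, fun p hp => ?_, fun p hp => ?_, fun P hP x y => ?_⟩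
  · refine contDiff_iff_contDiffAt.2 fun p => ?_
    by_cases hp : p ∈ strip e
    · exact (χ.contDiff.comp (E2.contDiff_apply 1)).contDiffAt.mul
        (hf.contDiffAt ((isOpen_strip e).mem_nhds hp))
    · have hp' : e ≤ |p 1| := not_lt.1 hp
      have : ∀ᶠ q : E2 in nhds p, (d + e) / 2 < |q 1| :=
        ((E2.continuous_apply 1).abs.tendsto p).eventually_const_lt (by linarith)
      refine (contDiffAt_const (c := (0:ℝ))).congr_of_eventuallyEq ?_
      filter_upwards [this] with q hq
      rw [hχ q hq.le, zero_mul]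
  · have : χ (p 1) = 1 := χ.one_of_mem_closedBall (by
      simpa [Real.dist_eq] using (show |p 1| ≤ d from hp))
    simp [this]
  · simp only
    rw [hχ p (by linarith), zero_mul]
  · by_cases hy : |y| < e
    · simp only
      rw [hP x y hy]; rfl
    · have h1 : (d + e) / 2 ≤ |y| := by linarith
      simp only
      rw [hχ !₂[x + P, y] h1, hχ !₂[x, y] h1, zero_mul, zero_mul]

theorem exists_bound_of_periodic {P : ℝ} (hP : 0 < P) {f : E2 → ℝ} (hf : Continuous f)
    (hper : PeriodicFst P f) (h0 : ∀ p, 1 ≤ |p 1| → f p = 0) : ∃ M, ∀ p, |f p| ≤ M := by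
  have hc : Continuous fun q : ℝ × ℝ => f !₂[q.1, q.2] :=
    hf.comp (E2.continuous_mk continuous_fst continuous_snd)
  obtain ⟨M, hM⟩ := ((isCompact_Icc (a := 0) (b := P)).prod (isCompact_Icc (a := (-1:ℝ)) (b := 1)))
    |>.exists_bound_of_continuousOn hc.continuousOn
  refine ⟨M, fun p => ?_⟩
  obtain ⟨k, hk⟩ := exists_add_int_mul_mem_Ico hP (p 0)
  by_cases hp : |p 1| ≤ 1
  · have h1 := hM (p 0 + k * P, p 1) ⟨⟨hk.1, hk.2.le⟩, abs_le.1 hp⟩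
    simp only [hper.int, E2.eta] at h1
    exact h1
  · rw [h0 p (not_le.1 hp).le, abs_zero]
    exact (norm_nonneg _).trans (hM (0, 0) ⟨⟨le_rfl, hP.le⟩, by norm_num⟩)

/-- The intermediate value theorem covers `[f 0, f 0 + Q]`, and integer translations cover the rest
of the line. -/
theorem surjective_of_add_period {f : ℝ → ℝ} (hf : Continuous f) {P Q : ℝ} (hQ : 0 < Q)
    (h : ∀ x, f (x + P) = f x + Q) : Function.Surjective f := by
  have hint : ∀ (k : ℤ) x, f (x + k * P) = f x + k * Q := by
    intro k
    induction k with
    | zero => simp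
    | succ n ih =>
      intro x
      have := h (x + n * P)
      push_cast at ih ⊢
      rw [ih] at this
      rw [show x + (n + 1) * P = x + n * P + P by ring, this]; ring
    | pred n ih =>
      intro x
      have := h (x + (-n - 1) * P)
      push_cast at ih ⊢
      rw [show x + (-n - 1) * P + P = x + -n * P by ring, ih] at this
      linarith
  intro b
  obtain ⟨k, hk⟩ := exists_add_int_mul_mem_Ico hQ (b - f 0)
  have h0 := h 0
  rw [zero_add] at h0
  have hmem : b + k * Q ∈ Set.uIcc (f 0) (f P) := by
    rw [h0, Set.uIcc_of_le (by linarith)]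
    exact ⟨by linarith [hk.1], by linarith [hk.2]⟩
  obtain ⟨t, -, ht⟩ := intermediate_value_uIcc hf.continuousOn hmem
  refine ⟨t + (-k : ℤ) * P, ?_⟩
  rw [hint, ht]
  push_cast
  ring

/-! ### Arc length and normal coordinates -/

/-- The arc length function `S` is a diffeomorphism of the line with `S (t + T) = S t + S T`.
Composing `γ` with its inverse `τ` gives unit speed and turns the period `T` into `S T`. -/
theorem exists_arcLengthParam {Γ : Set E2} (h : IsSmoothClosedCurve Γ) :
    ∃ ν l, IsArcLengthParam ν l Γ := by
  obtain ⟨T, γ, hT, hγ, hper, hinj, hne, rfl⟩ := h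
  have hγ' : ContDiff ℝ ∞ (deriv γ) := (contDiff_infty_iff_deriv.1 hγ).2
  have hv : ContDiff ℝ ∞ fun t => ‖deriv γ t‖ := hγ'.norm ℝ hne
  have hvper : Function.Periodic (fun t => ‖deriv γ t‖) T := fun t => by
    have h1 : (fun s => γ (s + T)) = γ := funext hper
    simp only
    rw [← deriv_comp_add_const, h1]
  set S : ℝ → ℝ := fun t => ∫ r in (0:ℝ)..t, ‖deriv γ r‖ with hS
  have hSd : ∀ t, HasDerivAt S ‖deriv γ t‖ t := fun t =>
    (hv.continuous.integral_hasStrictDerivAt 0 t).hasDerivAt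
  have hSc : ContDiff ℝ ∞ S := by
    refine contDiff_infty_iff_deriv.2 ⟨fun t => (hSd t).differentiableAt, ?_⟩
    rwa [funext fun t => (hSd t).deriv]
  have hSm : StrictMono S := strictMono_of_deriv_pos fun t => by
    rw [(hSd t).deriv]; exact norm_pos_iff.2 (hne t)
  have hS0 : S 0 = 0 := by simp [hS]
  have hl : 0 < S T := by rw [← hS0]; exact hSm hT
  have hSper : ∀ t, S (t + T) = S t + S T := fun t => by
    have h1 := intervalIntegral.integral_add_adjacent_intervals (a := 0) (b := t) (c := t + T)
      (hv.continuous.intervalIntegrable (μ := MeasureTheory.volume) _ _)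
      (hv.continuous.intervalIntegrable _ _)
    rw [hvper.intervalIntegral_add_eq t 0, zero_add] at h1
    exact h1.symm
  choose τ hτ using surjective_of_add_period hSc.continuous hl hSper
  have hτS : ∀ t, τ (S t) = t := fun t => hSm.injective (hτ _)
  have hτc : ContDiff ℝ ∞ τ := contDiff_of_inverse hSc
    (fun t => ⟨_, (hSd t).hasFDerivAt_equiv (norm_ne_zero_iff.2 (hne t))⟩) hτS hτ
  have hτper : ∀ s, τ (s + S T) = τ s + T := fun s => hSm.injective (by rw [hτ, hSper, hτ])
  have hτ0 : τ 0 = 0 := by simpa [hS0] using hτS 0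
  have hτm : StrictMono τ := fun a b hab => hSm.lt_iff_lt.1 (by rwa [hτ, hτ])
  refine ⟨γ ∘ τ, S T, hl, hγ.comp hτc, fun s => ?_, ?_, fun s => ?_, ?_⟩
  · simp only [Function.comp_apply]
    rw [hτper, hper]
  · intro a ha b hb hab
    have hmem : ∀ c ∈ Set.Ico 0 (S T), τ c ∈ Set.Ico 0 T := fun c hc => by
      refine ⟨?_, ?_⟩
      · rw [← hτ0]; exact hτm.monotone hc.1
      · rw [← hτS T]; exact hτm hc.2
    exact hτm.injective (hinj (hmem a ha) (hmem b hb) hab)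
  · have h1 : HasDerivAt τ (deriv τ s) s := (hτc.differentiable (by simp) s).hasDerivAt
    have h2 : HasDerivAt (S ∘ τ) (‖deriv γ (τ s)‖ * deriv τ s) s := (hSd (τ s)).comp s h1
    have h3 : S ∘ τ = id := funext hτ
    rw [h3] at h2
    have h4 := h2.unique (hasDerivAt_id s)
    have h5 : HasDerivAt (γ ∘ τ) (deriv τ s • deriv γ (τ s)) s :=
      ((hγ.differentiable (by simp) _).hasDerivAt).scomp s h1
    have h6 : 0 ≤ deriv τ s := hτm.monotone.deriv_nonneg
    rw [h5.deriv, norm_smul, Real.norm_of_nonneg h6, mul_comm, h4]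
  · exact (show Function.Surjective τ from fun t => ⟨S t, hτS t⟩).range_comp γ

theorem IsArcLengthParam.eq_iff {ν : ℝ → E2} {l : ℝ} {Γ : Set E2} (h : IsArcLengthParam ν l Γ)
    (s t : ℝ) : ν s = ν t ↔ ∃ k : ℤ, t = s + k * l := by
  obtain ⟨hl, -, hper, hinj, -, -⟩ := h
  have hint : ∀ (k : ℤ) s, ν (s + k * l) = ν s := fun k => hper.int_mul k
  constructor
  · intro hst
    obtain ⟨j, hj⟩ := exists_add_int_mul_mem_Ico hl s
    obtain ⟨k, hk⟩ := exists_add_int_mul_mem_Ico hl t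
    have := hinj hj hk (by rw [hint, hint, hst])
    refine ⟨j - k, ?_⟩
    push_cast
    linarith
  · rintro ⟨k, rfl⟩
    exact (hint k s).symm

theorem pd_zero_eq_deriv {u : E2 → ℝ} {x y : ℝ} (hu : DifferentiableAt ℝ u !₂[x, y]) :
    HasDerivAt (fun t => u !₂[t, y]) (pd 0 u !₂[x, y]) x := by
  have h1 : HasDerivAt (fun t : ℝ => (!₂[t, y] : E2)) (EuclideanSpace.single 0 1) x := by
    have : (fun t : ℝ => (!₂[t, y] : E2)) =
        fun t => t • EuclideanSpace.single (0 : Fin 2) (1 : ℝ) + !₂[0, y] := by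
      funext t; ext i; fin_cases i <;> simp
    rw [this]
    simpa using ((hasDerivAt_id x).smul_const
      (EuclideanSpace.single (0 : Fin 2) (1 : ℝ))).add_const (!₂[0, y] : E2)
  exact hu.hasFDerivAt.comp_hasDerivAt x h1

theorem pd_one_eq_deriv {u : E2 → ℝ} {x y : ℝ} (hu : DifferentiableAt ℝ u !₂[x, y]) :
    HasDerivAt (fun t => u !₂[x, t]) (pd 1 u !₂[x, y]) y := by
  have h1 : HasDerivAt (fun t : ℝ => (!₂[x, t] : E2)) (EuclideanSpace.single 1 1) y := by
    have : (fun t : ℝ => (!₂[x, t] : E2)) =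
        fun t => t • EuclideanSpace.single (1 : Fin 2) (1 : ℝ) + !₂[x, 0] := by
      funext t; ext i; fin_cases i <;> simp
    rw [this]
    simpa using ((hasDerivAt_id y).smul_const
      (EuclideanSpace.single (1 : Fin 2) (1 : ℝ))).add_const (!₂[x, 0] : E2)
  exact hu.hasFDerivAt.comp_hasDerivAt y h1

/-- A periodic local diffeomorphism that is injective modulo the period on the axis is so on
a strip. -/
theorem exists_eq_iff_on_strip {X : E2 → E2} {l : ℝ} (hl : 0 < l) (hX : ContDiff ℝ ∞ X)
    (hper : PeriodicFst l X) (hdet : ∀ x : ℝ, (jacobian X !₂[x, 0]).det ≠ 0)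
    (haxis : ∀ x y : ℝ, X !₂[x, 0] = X !₂[y, 0] → ∃ k : ℤ, y = x + k * l) :
    ∃ d > 0, ∀ s ∈ closedStrip d, ∀ t ∈ closedStrip d,
      X s = X t ↔ s 1 = t 1 ∧ ∃ k : ℤ, t 0 = s 0 + k * l := by
  have : Fact (0 < l) := ⟨hl⟩
  have hp : ∀ y, Function.Periodic (fun x => X !₂[x, y]) l := fun y x => hper x y
  -- On the cylinder the axis becomes a compact circle. A continuous map that is injective on a
  -- compact set and locally injective at its points is injective on a neighbourhood of that set.
  let f : AddCircle l × ℝ → E2 := fun q => (hp q.2).lift q.1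
  let π : ℝ × ℝ → AddCircle l × ℝ := Prod.map (fun x : ℝ => (x : AddCircle l)) id
  have hfπ : ∀ q : ℝ × ℝ, f (π q) = X !₂[q.1, q.2] := fun q => Function.Periodic.lift_coe _ _
  have hπ : IsOpenQuotientMap π :=
    IsOpenQuotientMap.prodMap QuotientAddGroup.isOpenQuotientMap_mk IsOpenQuotientMap.id
  have hmk : Continuous fun q : ℝ × ℝ => (!₂[q.1, q.2] : E2) :=
    E2.continuous_mk continuous_fst continuous_snd
  have hfc : Continuous f := hπ.continuous_comp_iff.1 (by
    rw [show f ∘ π = fun q : ℝ × ℝ => X !₂[q.1, q.2] from funext hfπ]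
    exact hX.continuous.comp hmk)
  have hK : IsCompact (Set.univ ×ˢ {0} : Set (AddCircle l × ℝ)) :=
    isCompact_univ.prod isCompact_singleton
  have hinj : Set.InjOn f (Set.univ ×ˢ {0}) := by
    rintro ⟨a, a'⟩ ⟨-, rfl : a' = 0⟩ ⟨b, b'⟩ ⟨-, rfl : b' = 0⟩ hab
    induction a using QuotientAddGroup.induction_on with | H a => ?_
    induction b using QuotientAddGroup.induction_on with | H b => ?_
    obtain ⟨k, rfl⟩ := haxis a b ((hfπ (a, 0)).symm.trans (hab.trans (hfπ (b, 0))))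
    refine Prod.ext ?_ rfl
    change ((a : ℝ) : AddCircle l) = ((a + k * l : ℝ) : AddCircle l)
    rw [AddCircle.coe_add, (AddCircle.coe_eq_zero_iff l (x := k * l)).2 ⟨k, by simp⟩, add_zero]
  obtain ⟨t, ht, htinj⟩ := hinj.exists_mem_nhdsSet hK (fun _ _ => hfc.continuousAt) (by
    rintro ⟨a, a'⟩ ⟨-, rfl : a' = 0⟩
    induction a using QuotientAddGroup.induction_on with | H a => ?_
    obtain ⟨U, hU, hUi⟩ := exists_injOn_of_det_ne_zero hX.contDiffAt (hdet a)
    refine ⟨π '' ((fun q : ℝ × ℝ => (!₂[q.1, q.2] : E2)) ⁻¹' U),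
      hπ.isOpenMap.image_mem_nhds (x := (a, 0)) (hmk.continuousAt.preimage_mem_nhds hU), ?_⟩
    rintro _ ⟨p, hp, rfl⟩ _ ⟨q, hq, rfl⟩ hpq
    rw [hfπ, hfπ] at hpq
    have := hUi hp hq hpq
    have h0 : p.1 = q.1 := congrArg (fun z : E2 => z 0) this
    have h1 : p.2 = q.2 := congrArg (fun z : E2 => z 1) this
    rw [Prod.ext h0 h1])
  have hcoe : Continuous fun p : E2 => π (p 0, p 1) :=
    hπ.continuous.comp ((E2.continuous_apply 0).prodMk (E2.continuous_apply 1))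
  obtain ⟨d, hd, hdt⟩ := exists_closedStrip_subset hl (U := (fun p : E2 => π (p 0, p 1)) ⁻¹' t)
    (fun x => hcoe.continuousAt.preimage_mem_nhds (mem_nhdsSet_iff_forall.1 ht _ ⟨trivial, rfl⟩))
    (fun x y => by
      have : π (x + l, y) = π (x, y) := Prod.ext (AddCircle.coe_add_period l x) rfl
      change (π (x + l, y) ∈ t) = (π (x, y) ∈ t)
      rw [this])
  refine ⟨d, hd, fun p hp q hq => ⟨fun h => ?_, ?_⟩⟩
  · have := htinj (hdt hp) (hdt hq) (by
      rw [hfπ, hfπ]; simpa only [E2.eta] using h)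
    have h0 : ((p 0 : ℝ) : AddCircle l) = (q 0 : ℝ) := congrArg Prod.fst this
    have h1 : p 1 = q 1 := congrArg Prod.snd this
    refine ⟨h1, ?_⟩
    obtain ⟨k, hk⟩ := (QuotientAddGroup.eq_iff_sub_mem.1 h0.symm)
    exact ⟨k, by simp at hk; linarith⟩
  · rintro ⟨h1, k, hk⟩
    rw [← E2.eta q, hk, ← h1, hper.int, E2.eta]

theorem norm_unitNormal {φ : E2 → ℝ} {ξ : E2} (h : gradient φ ξ ≠ 0) : ‖unitNormal φ ξ‖ = 1 := by
  rw [unitNormal, norm_smul, norm_inv, norm_norm, inv_mul_cancel₀ (norm_ne_zero_iff.2 h)]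

theorem inner_gradient_eq (φ : E2 → ℝ) (ξ v : E2) : inner ℝ (gradient φ ξ) v = fderiv ℝ φ ξ v := by
  rw [gradient, InnerProductSpace.toDual_symm_apply]

theorem inner_unitNormal (φ : E2 → ℝ) (ξ v : E2) :
    inner ℝ (unitNormal φ ξ) v = ‖gradient φ ξ‖⁻¹ * fderiv ℝ φ ξ v := by
  rw [unitNormal, real_inner_smul_left, inner_gradient_eq]

theorem fderiv_unitNormal {φ : E2 → ℝ} {ξ : E2} (h : gradient φ ξ ≠ 0) :
    fderiv ℝ φ ξ (unitNormal φ ξ) = ‖gradient φ ξ‖ := by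
  rw [← inner_gradient_eq, unitNormal, real_inner_smul_right, real_inner_self_eq_norm_sq]
  have := norm_ne_zero_iff.2 h
  field_simp

theorem contDiffAt_unitNormal {φ : E2 → ℝ} {ξ : E2} (hφ : ContDiffAt ℝ ∞ φ ξ)
    (h : gradient φ ξ ≠ 0) : ContDiffAt ℝ ∞ (unitNormal φ) ξ := by
  have hg : ContDiffAt ℝ ∞ (gradient φ) ξ :=
    ((InnerProductSpace.toDual ℝ E2).symm.contDiff (n := ∞)).contDiffAt.comp ξ
      (hφ.fderiv_right (m := ∞) (by simp))
  exact ((hg.norm ℝ h).inv (norm_ne_zero_iff.2 h)).smul hg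

/-- Lagrange's identity: the squared determinant is `|u|² |v|² - ⟨u, v⟩²`. -/
theorem det_sq_of_orthonormal {u v : E2} (hu : ‖u‖ = 1) (hv : ‖v‖ = 1) (huv : inner ℝ u v = (0:ℝ)) :
    (u 0 * v 1 - v 0 * u 1) ^ 2 = 1 := by
  have h1 : u 0 ^ 2 + u 1 ^ 2 = 1 := by
    have := EuclideanSpace.norm_sq_eq u
    rw [hu] at this
    simpa [Fin.sum_univ_two] using this.symm
  have h2 : v 0 ^ 2 + v 1 ^ 2 = 1 := by
    have := EuclideanSpace.norm_sq_eq v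
    rw [hv] at this
    simpa [Fin.sum_univ_two] using this.symm
  have h3 : v 0 * u 0 + v 1 * u 1 = 0 := by
    simpa [PiLp.inner_apply, Fin.sum_univ_two] using huv
  linear_combination (v 0 ^ 2 + v 1 ^ 2) * h1 + h2 - (v 0 * u 0 + v 1 * u 1) * h3

theorem contDiff_det_jacobian {X : E2 → E2} (hX : ContDiff ℝ ∞ X) :
    ContDiff ℝ ∞ fun s => (jacobian X s).det := by
  have h : ∀ i j, ContDiff ℝ ∞ fun s => jacobian X s i j := fun i j =>
    contDiffOn_univ.1 (contDiffOn_jacobian isOpen_univ hX.contDiffOn i j)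
  simp only [Matrix.det_fin_two]
  exact ((h 0 0).mul (h 1 1)).sub ((h 0 1).mul (h 1 0))

section NormalCoordinates

variable {Ω : Set E2} {φ : E2 → ℝ} {Γ : Set E2} {ν : ℝ → E2} {l : ℝ}

theorem contDiff_normalCoord (hΩ : IsOpen Ω) (hφ : ContDiffOn ℝ ∞ φ Ω) (hν : ContDiff ℝ ∞ ν)
    (hνΩ : ∀ s, ν s ∈ Ω) (hgrad : ∀ s, gradient φ (ν s) ≠ 0) :
    ContDiff ℝ ∞ (normalCoord φ ν) := by
  have hN : ContDiff ℝ ∞ fun s => unitNormal φ (ν s) := contDiff_iff_contDiffAt.2 fun s =>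
    (contDiffAt_unitNormal (hφ.contDiffAt (hΩ.mem_nhds (hνΩ s))) (hgrad s)).comp s hν.contDiffAt
  exact (hν.comp (E2.contDiff_apply 0)).add
    ((E2.contDiff_apply 1).smul (hN.comp (E2.contDiff_apply 0)))

theorem periodicFst_normalCoord (hper : Function.Periodic ν l) :
    PeriodicFst l (normalCoord φ ν) := fun x y => by
  change ν (x + l) + y • unitNormal φ (ν (x + l)) = ν x + y • unitNormal φ (ν x)
  rw [hper x]

theorem normalCoord_axis (x : ℝ) : normalCoord φ ν !₂[x, 0] = ν x := by
  simp [normalCoord]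

theorem jacobian_normalCoord_zero (hX : ContDiff ℝ ∞ (normalCoord φ ν)) (hν : ContDiff ℝ ∞ ν)
    (x : ℝ) (k : Fin 2) : jacobian (normalCoord φ ν) !₂[x, 0] k 0 = deriv ν x k := by
  have hd : DifferentiableAt ℝ (fun q => normalCoord φ ν q k) !₂[x, 0] :=
    ((E2.contDiff_apply k).comp hX).differentiable (n := ∞) (by simp) _
  refine (pd_zero_eq_deriv hd).unique ?_
  simp only [normalCoord_axis]
  exact ((EuclideanSpace.proj (𝕜 := ℝ) (ι := Fin 2) k).hasFDerivAt).comp_hasDerivAt x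
    (hν.differentiable (by simp) x).hasDerivAt

theorem jacobian_normalCoord_one (hX : ContDiff ℝ ∞ (normalCoord φ ν))
    (x y : ℝ) (k : Fin 2) :
    jacobian (normalCoord φ ν) !₂[x, y] k 1 = unitNormal φ (ν x) k := by
  have hd : DifferentiableAt ℝ (fun q => normalCoord φ ν q k) !₂[x, y] :=
    ((E2.contDiff_apply k).comp hX).differentiable (n := ∞) (by simp) _
  refine (pd_one_eq_deriv hd).unique ?_
  have : HasDerivAt (fun t : ℝ => ν x k + t * unitNormal φ (ν x) k) (unitNormal φ (ν x) k) y := by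
    simpa using ((hasDerivAt_id y).mul_const (unitNormal φ (ν x) k)).const_add (ν x k)
  exact this

/-- The normal coordinates are regular near the curve, and `φ` vanishes there to first order. -/
theorem exists_tubular (hΩ : IsOpen Ω) (hφ : ContDiffOn ℝ ∞ φ Ω)
    (hΓ : Γ = {ξ | ξ ∈ Ω ∧ φ ξ = 0}) (hgrad : ∀ ξ ∈ Γ, gradient φ ξ ≠ 0)
    (hν : IsArcLengthParam ν l Γ) :
    ContDiff ℝ ∞ (normalCoord φ ν) ∧ PeriodicFst l (normalCoord φ ν) ∧ ∃ d > 0,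
      (∀ s ∈ strip d, normalCoord φ ν s ∈ Ω) ∧
      (∀ s ∈ strip d, (jacobian (normalCoord φ ν) s).det ≠ 0) ∧
      (∀ s ∈ strip d, ∀ t ∈ strip d, normalCoord φ ν s = normalCoord φ ν t ↔
        s 1 = t 1 ∧ ∃ k : ℤ, t 0 = s 0 + k * l) ∧
      ∃ h : E2 → ℝ, ContDiff ℝ ∞ h ∧ PeriodicFst l h ∧
        ∀ s ∈ strip d, 0 < h s ∧ φ (normalCoord φ ν s) = s 1 * h s := by
  have hνΓ : ∀ s, ν s ∈ Γ := fun s => by rw [← hν.2.2.2.2.2]; exact Set.mem_range_self s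
  have hνΩ : ∀ s, ν s ∈ Ω := fun s => by have := hνΓ s; rw [hΓ] at this; exact this.1
  have hν0 : ∀ s, φ (ν s) = 0 := fun s => by have := hνΓ s; rw [hΓ] at this; exact this.2
  have hνg : ∀ s, gradient φ (ν s) ≠ 0 := fun s => hgrad _ (hνΓ s)
  have hiff := hν.eq_iff
  obtain ⟨hl, hνc, hper, -, hunit, -⟩ := hν
  have hX := contDiff_normalCoord hΩ hφ hνc hνΩ hνg
  have hXp : PeriodicFst l (normalCoord φ ν) := periodicFst_normalCoord hper
  refine ⟨hX, hXp, ?_⟩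
  set X := normalCoord φ ν with hXdef
  have hφd : ∀ ξ ∈ Ω, DifferentiableAt ℝ φ ξ := fun ξ hξ =>
    (hφ.contDiffAt (hΩ.mem_nhds hξ)).differentiableAt (by simp)
  -- Differentiate `φ ∘ ν = 0`.
  have horth : ∀ x, inner ℝ (deriv ν x) (unitNormal φ (ν x)) = (0:ℝ) := fun x => by
    have h1 := (hφd _ (hνΩ x)).hasFDerivAt.comp_hasDerivAt x
      (hνc.differentiable (by simp) x).hasDerivAt
    rw [show φ ∘ ν = fun _ => 0 from funext hν0] at h1
    rw [real_inner_comm, inner_unitNormal, h1.unique (hasDerivAt_const x 0), mul_zero]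
  have hdet : ∀ x : ℝ, (jacobian X !₂[x, 0]).det ≠ 0 := fun x h0 => by
    rw [Matrix.det_fin_two, jacobian_normalCoord_zero hX hνc, jacobian_normalCoord_zero hX hνc,
      jacobian_normalCoord_one hX, jacobian_normalCoord_one hX] at h0
    have := det_sq_of_orthonormal (hunit x) (norm_unitNormal (hνg x)) (horth x)
    rw [h0] at this
    norm_num at this
  obtain ⟨d₁, hd₁, h₁⟩ := exists_closedStrip_subset hl
    (U := {s | X s ∈ Ω ∧ (jacobian X s).det ≠ 0})
    (fun x => ((hΩ.preimage hX.continuous).inter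
      (isOpen_ne_fun (contDiff_det_jacobian hX).continuous continuous_const)).mem_nhds
      ⟨by simpa only [Set.mem_preimage, hXdef, normalCoord_axis] using hνΩ x, hdet x⟩)
    (fun x y => by simp only [Set.mem_ofPred_eq]; rw [hXp x y, hXp.jacobian x y])
  obtain ⟨d₂, hd₂, h₂⟩ := exists_eq_iff_on_strip hl hX hXp hdet (fun x y hxy => by
    rw [hXdef, normalCoord_axis, normalCoord_axis] at hxy
    exact (hiff x y).1 hxy)
  have hφX : ContDiffOn ℝ ∞ (fun s => φ (X s)) (strip d₁) :=
    hφ.comp hX.contDiffOn fun s hs => (h₁ (strip_subset_closedStrip _ hs)).1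
  obtain ⟨G, hG, hGeq, -, hGp⟩ := exists_extension (half_pos hd₁) (half_lt_self hd₁) hφX
  have hGp' := hGp l fun x y _ => by rw [hXp]
  -- The coordinates are swapped because `exists_smooth_slope` divides in the first variable, while
  -- `φ ∘ X` is to be divided by `s₂`. The extension `G` is used since `φ ∘ X` is smooth only on a
  -- strip.
  obtain ⟨Q, hQ, hGQ, hQ0, -, hQp⟩ := exists_smooth_slope (g := fun q : ℝ × ℝ => G !₂[q.2, q.1])
    (hG.comp (E2.contDiff_mk contDiff_snd contDiff_fst))
  set h : E2 → ℝ := fun p => Q (0, p 1, p 0) with hh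
  have hc : ContDiff ℝ ∞ h :=
    hQ.comp (contDiff_const.prodMk ((E2.contDiff_apply 1).prodMk (E2.contDiff_apply 0)))
  have hhp : PeriodicFst l h := fun x y => hQp l (fun a y => hGp' y a) 0 y x
  have hax : ∀ x : ℝ, (!₂[x, 0] : E2) ∈ closedStrip (d₁ / 2) := fun x => by
    change |(0:ℝ)| ≤ d₁ / 2
    rw [abs_zero]; linarith
  have hG0 : ∀ x, G !₂[x, 0] = 0 := fun x => by
    rw [hGeq _ (hax x), hXdef, normalCoord_axis, hν0]
  have hfac : ∀ s ∈ closedStrip (d₁ / 2), φ (X s) = s 1 * h s := fun s hs => by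
    have := hGQ 0 (s 1) (s 0)
    simp only [hG0, sub_zero, E2.eta] at this
    rw [← hGeq s hs, this, mul_comm]
  -- The normal derivative of `φ ∘ X` on the axis is computed twice: it is `|∇φ|` by the chain rule
  -- and `h` by the factorization.
  have hpos : ∀ x : ℝ, 0 < h !₂[x, 0] := fun x => by
    have h1 : HasDerivAt (fun t => X !₂[x, t]) (unitNormal φ (ν x)) 0 := by
      have : HasDerivAt (fun t : ℝ => ν x + t • unitNormal φ (ν x)) (unitNormal φ (ν x)) 0 := by
        simpa using ((hasDerivAt_id (0:ℝ)).smul_const (unitNormal φ (ν x))).const_add (ν x)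
      exact this
    have h2 : HasDerivAt (fun t => φ (X !₂[x, t])) ‖gradient φ (ν x)‖ 0 := by
      have hx0 : X !₂[x, 0] = ν x := normalCoord_axis x
      have h3 := (hφd _ (hνΩ x)).hasFDerivAt
      rw [← hx0] at h3
      have := h3.comp_hasDerivAt (0:ℝ) h1
      rwa [hx0, fderiv_unitNormal (hνg x)] at this
    have h3 : HasDerivAt (fun t => t * h !₂[x, t]) (h !₂[x, 0]) 0 := by
      have hd : DifferentiableAt ℝ (fun t => h !₂[x, t]) 0 :=
        (hc.comp (E2.contDiff_mk contDiff_const contDiff_id)).differentiable (by simp) 0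
      exact ((hasDerivAt_id (0:ℝ)).mul hd.hasDerivAt).congr_deriv (by simp)
    have h4 : (fun t => φ (X !₂[x, t])) =ᶠ[nhds 0] fun t => t * h !₂[x, t] := by
      filter_upwards [Metric.closedBall_mem_nhds (0:ℝ) (half_pos hd₁)] with t ht
      exact hfac !₂[x, t] (show |t| ≤ d₁ / 2 by simpa using ht)
    rw [← (h2.congr_of_eventuallyEq h4.symm).unique h3]
    exact norm_pos_iff.2 (hνg x)
  obtain ⟨d₃, hd₃, h₃⟩ := exists_closedStrip_subset hl (U := {s | 0 < h s})
    (fun x => (isOpen_lt continuous_const hc.continuous).mem_nhds (hpos x))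
    (fun x y => by simp only [Set.mem_ofPred_eq]; rw [hhp x y])
  have hsub : ∀ s ∈ strip (min (d₁ / 2) (min d₂ d₃)),
      s ∈ closedStrip (d₁ / 2) ∧ s ∈ closedStrip d₂ ∧ s ∈ closedStrip d₃ := fun s hs =>
    ⟨strip_subset_closedStrip _ (strip_mono (min_le_left _ _) hs),
      strip_subset_closedStrip _ (strip_mono ((min_le_right _ _).trans (min_le_left _ _)) hs),
      strip_subset_closedStrip _ (strip_mono ((min_le_right _ _).trans (min_le_right _ _)) hs)⟩
  have hsub₁ : closedStrip (d₁ / 2) ⊆ closedStrip d₁ := fun s hs =>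
    (show |s 1| ≤ d₁ / 2 from hs).trans (half_le_self hd₁.le)
  exact ⟨min (d₁ / 2) (min d₂ d₃), lt_min (half_pos hd₁) (lt_min hd₂ hd₃),
    fun s hs => (h₁ (hsub₁ (hsub s hs).1)).1, fun s hs => (h₁ (hsub₁ (hsub s hs).1)).2,
    fun s hs t ht => h₂ s (hsub s hs).2.1 t (hsub t ht).2.1,
    h, hc, hhp, fun s hs => ⟨h₃ (hsub s hs).2.2, hfac s (hsub s hs).1⟩⟩

end NormalCoordinates

/-! ### Characteristic coordinates -/

theorem PeriodicFst.comp₂ {α β γ : Type*} {P : ℝ} {f : E2 → α} {f' : E2 → β}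
    (h : PeriodicFst P f) (h' : PeriodicFst P f') (g : α → β → γ) :
    PeriodicFst P fun p => g (f p) (f' p) := fun x y => by
  simp only [h x y, h' x y]

/-- The map that replaces the first coordinate by `θ`. -/
noncomputable def shear (θ : E2 → ℝ) (p : E2) : E2 := !₂[θ p, p 1]

theorem contDiff_shear {θ : E2 → ℝ} (hθ : ContDiff ℝ ∞ θ) : ContDiff ℝ ∞ (shear θ) :=
  E2.contDiff_mk hθ (E2.contDiff_apply 1)

theorem pd_apply (i k : Fin 2) (p : E2) : pd i (fun q => q k) p = if i = k then 1 else 0 := by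
  rw [pd, show (fun q : E2 => q k) = ⇑(EuclideanSpace.proj (𝕜 := ℝ) (ι := Fin 2) k) from rfl,
    ContinuousLinearMap.fderiv]
  fin_cases i <;> fin_cases k <;> simp

theorem jacobian_shear (θ : E2 → ℝ) (p : E2) :
    jacobian (shear θ) p = !![pd 0 θ p, pd 1 θ p; 0, 1] := by
  ext k i
  fin_cases k
  · fin_cases i <;> rfl
  · change pd i (fun q => q 1) p = _
    rw [pd_apply]
    fin_cases i <;> simp

/-- Coordinates that are constant along the characteristics of `g ∂₁ + ∂₂`. -/
theorem exists_characteristic_coordinates {g : E2 → ℝ} (hg : ContDiff ℝ ∞ g) {l r c : ℝ}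
    (hl : 0 < l) (hr : 0 < r) (hper : PeriodicFst l g) (h0 : ∀ p, 1 ≤ |p 1| → g p = 0) :
    ∃ ψ θ : E2 → ℝ, ContDiff ℝ ∞ ψ ∧ ContDiff ℝ ∞ θ ∧
      (∀ x, ψ !₂[x, 0] = x) ∧ (∀ x y, ψ !₂[x + l, y] = ψ !₂[x, y] + l) ∧
      (∀ s, 0 < pd 0 ψ s) ∧ (∀ s, g s * pd 0 ψ s + pd 1 ψ s = 0) ∧
      (∀ p, 0 < pd 0 θ p) ∧ (∀ p, pd 1 θ p = g (shear θ p)) ∧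
      (∀ x y, θ !₂[x + l / r, y] = θ !₂[x, y] + l) ∧
      (∀ p, ψ (shear θ p) = r * (p 0 + c)) ∧ ∀ s, θ !₂[ψ s / r - c, s 1] = s 0 := by
  obtain ⟨M, hM⟩ := exists_bound_of_periodic hl hg.continuous hper h0
  have hgx : Continuous (pd 0 g) := (contDiffOn_univ.1 (contDiffOn_pd isOpen_univ
    hg.contDiffOn 0)).continuous
  obtain ⟨K, hK⟩ := exists_bound_of_periodic hl hgx (hper.pd 0) (fun p hp => by
    have h1 := pd_zero_eq_deriv (x := p 0) (y := p 1) (hg.differentiable (by simp) _)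
    rw [E2.eta, show (fun t => g !₂[t, p 1]) = fun _ => 0 from funext fun t => h0 _ hp] at h1
    exact h1.unique (hasDerivAt_const _ _))
  set G : ℝ × ℝ → ℝ := fun q => g !₂[q.1, q.2] with hGdef
  have hmk : ContDiff ℝ ∞ fun q : ℝ × ℝ => (!₂[q.1, q.2] : E2) :=
    E2.contDiff_mk contDiff_fst contDiff_snd
  have hG : ContDiff ℝ ∞ G := hg.comp hmk
  have hGK : ∀ q, |fderiv ℝ G q (1, 0)| ≤ K := fun q => by
    have h1 : HasDerivAt (fun t : ℝ => ((t, q.2) : ℝ × ℝ)) (1, 0) q.1 :=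
      (hasDerivAt_id q.1).prodMk (hasDerivAt_const _ _)
    have h2 := (hG.differentiable (by simp) (q.1, q.2)).hasFDerivAt.comp_hasDerivAt q.1 h1
    have h3 := pd_zero_eq_deriv (x := q.1) (y := q.2) (hg.differentiable (by simp) _)
    have h4 := h2.unique h3
    rw [Prod.mk.eta] at h4
    rw [h4]
    exact hK _
  obtain ⟨Θ, hΘ⟩ := exists_isFlow hG (fun x y hy => h0 _ hy) (fun q => hM _) hGK
  have hΘc := hΘ.continuous hG hGK
  have hΘs : ContDiff ℝ ∞ Θ := hΘ.contDiff hG hΘc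
  have hΘm := fun y => hΘ.strictMono hG y
  have hΘp := fun x y => hΘ.add_period hG (fun x y => hper x y) x y
  have hsurj : ∀ y, Function.Surjective fun x => Θ (x, y) := fun y =>
    surjective_of_add_period (hΘc.comp (by fun_prop)) hl fun x => hΘp x y
  choose ψ₀ hψ₀ using hsurj
  have hψ₀' : ∀ y x, ψ₀ y (Θ (x, y)) = x := fun y x => (hΘm y).injective (hψ₀ y _)
  set T : E2 → ℝ := fun p => Θ (p 0, p 1) with hT
  have hTs : ContDiff ℝ ∞ T := hΘs.comp ((E2.contDiff_apply 0).prodMk (E2.contDiff_apply 1))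
  have hTd : ∀ p, DifferentiableAt ℝ T p := fun p => hTs.differentiable (by simp) p
  have hT0 : ∀ p, 0 < pd 0 T p := fun p => by
    have h1 := pd_zero_eq_deriv (x := p 0) (y := p 1) (hTd _)
    rw [E2.eta] at h1
    rw [h1.unique (hΘ.hasDerivAt_fst hG hΘc (p 0) (p 1))]
    exact Real.exp_pos _
  have hT1 : ∀ p, pd 1 T p = g (shear T p) := fun p => by
    have h1 := pd_one_eq_deriv (x := p 0) (y := p 1) (hTd _)
    rw [E2.eta] at h1
    exact h1.unique (hΘ.sol (p 0) (p 1))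
  -- `ψ` sends a point to the initial value of the characteristic through it, so `shear ψ` and
  -- `shear T` are mutually inverse.
  set ψ : E2 → ℝ := fun p => ψ₀ (p 1) (p 0) with hψdef
  have hl' : ∀ p, shear ψ (shear T p) = p := fun p => by
    refine Eq.trans ?_ (E2.eta p)
    change (!₂[ψ₀ (p 1) (Θ (p 0, p 1)), p 1] : E2) = _
    rw [hψ₀']
  have hr' : ∀ p, shear T (shear ψ p) = p := fun p => by
    refine Eq.trans ?_ (E2.eta p)
    change (!₂[Θ (ψ₀ (p 1) (p 0), p 1), p 1] : E2) = _
    have := hψ₀ (p 1) (p 0)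
    simp only at this
    rw [this]
  have hsT : ContDiff ℝ ∞ (shear T) := contDiff_shear hTs
  have hsψ : ContDiff ℝ ∞ (shear ψ) := contDiff_of_inverse hsT (fun p =>
    exists_equiv_of_det_ne_zero (hsT.differentiable (by simp) p) (by
      rw [jacobian_shear, Matrix.det_fin_two_of]
      simpa using (hT0 p).ne')) hl' hr'
  have hψs : ContDiff ℝ ∞ ψ := (E2.contDiff_apply 0).comp hsψ
  have hψd : ∀ p, DifferentiableAt ℝ ψ p := fun p => hψs.differentiable (by simp) p
  have hψT : ψ ∘ shear T = fun p => p 0 := funext fun p => hψ₀' (p 1) (p 0)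
  -- Differentiating `ψ ∘ shear T = p 0` in the first variable gives the sign of `ψ₁`, and in the
  -- second the transport equation.
  have hchain : ∀ p i, pd 0 ψ (shear T p) * jacobian (shear T) p 0 i +
      pd 1 ψ (shear T p) * jacobian (shear T) p 1 i = if i = 0 then 1 else 0 := fun p i => by
    rw [← pd_comp (hψd _) (hsT.differentiable (by simp) p), hψT, pd_apply]
  have hch0 : ∀ p, pd 0 ψ (shear T p) * pd 0 T p = 1 := fun p => by
    have := hchain p 0
    rw [jacobian_shear] at this
    simpa using this
  have hch1 : ∀ p, pd 0 ψ (shear T p) * g (shear T p) + pd 1 ψ (shear T p) = 0 := fun p => by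
    have := hchain p 1
    rw [jacobian_shear] at this
    simpa [hT1] using this
  -- `R` inverts the normalization `x = ψ / r - c` of the initial value, so `T ∘ R` is the flow in
  -- the variable `x`.
  set R : E2 → E2 := fun p => !₂[r * (p 0 + c), p 1] with hR
  have hRs : ContDiff ℝ ∞ R := E2.contDiff_mk
    (contDiff_const.mul ((E2.contDiff_apply 0).add contDiff_const)) (E2.contDiff_apply 1)
  have hθs : ContDiff ℝ ∞ (T ∘ R) := hTs.comp hRs
  have hθd : ∀ p, DifferentiableAt ℝ (T ∘ R) p := fun p => hθs.differentiable (by simp) p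
  refine ⟨ψ, T ∘ R, hψs, hθs, fun x => ?_, fun x y => ?_, fun s => ?_, fun s => ?_, fun p => ?_,
    fun p => ?_, fun x y => ?_, fun p => ?_, fun s => ?_⟩
  · change ψ₀ 0 x = x
    conv_lhs => rw [← hΘ.zero x]
    exact hψ₀' 0 x
  · refine (hΘm y).injective ?_
    have h1 := hψ₀ y (x + l)
    have h2 := hψ₀ y x
    simp only at h1 h2
    change Θ (ψ₀ y (x + l), y) = Θ (ψ₀ y x + l, y)
    rw [h1, hΘp, h2]
  · have h1 := hch0 (shear ψ s)
    rw [hr'] at h1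
    exact pos_of_mul_pos_left (by rw [h1]; exact one_pos) (hT0 _).le
  · have h1 := hch1 (shear ψ s)
    rw [hr'] at h1
    linarith
  · have h1 := pd_zero_eq_deriv (x := p 0) (y := p 1) (hθd _)
    have h2 := pd_zero_eq_deriv (x := r * (p 0 + c)) (y := p 1) (hTd _)
    have h3 : HasDerivAt (fun t => r * (t + c)) r (p 0) := by
      simpa using ((hasDerivAt_id (p 0)).add_const c).const_mul r
    have h4 := h1.unique (h2.comp (p 0) h3)
    rw [E2.eta] at h4
    rw [h4]
    exact mul_pos (hT0 _) hr
  · have h1 := pd_one_eq_deriv (x := p 0) (y := p 1) (hθd _)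
    have h2 := pd_one_eq_deriv (x := r * (p 0 + c)) (y := p 1) (hTd _)
    have h4 := h1.unique h2
    rw [E2.eta] at h4
    rw [h4]
    exact hT1 _
  · change Θ (r * (x + l / r + c), y) = Θ (r * (x + c), y) + l
    rw [← hΘp]
    congr 2
    field_simp
    ring
  · exact hψ₀' (p 1) _
  · change Θ (r * (ψ s / r - c + c), s 1) = s 0
    rw [sub_add_cancel, mul_div_cancel₀ _ hr.ne']
    exact hψ₀ (s 1) (s 0)

/-! ### Change of variables in the operator -/

section Transformation

variable {S : Set E2} {Ψ : E2 → E2}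

theorem contDiffOn_jacobian_inv (hS : IsOpen S) (hΨ : ContDiffOn ℝ ∞ Ψ S)
    (hdet : ∀ p ∈ S, (jacobian Ψ p).det ≠ 0) (i j : Fin 2) :
    ContDiffOn ℝ ∞ (fun p => (jacobian Ψ p)⁻¹ i j) S := by
  have h := contDiffOn_jacobian hS hΨ
  have hd : ContDiffOn ℝ ∞ (fun p => ((jacobian Ψ p).det)⁻¹) S := by
    refine ContDiffOn.inv ?_ hdet
    simp only [Matrix.det_fin_two]
    exact ((h 0 0).mul (h 1 1)).sub ((h 0 1).mul (h 1 0))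
  have ha : ContDiffOn ℝ ∞ (fun p => (jacobian Ψ p).adjugate i j) S := by
    simp only [Matrix.adjugate_fin_two]
    fin_cases i <;> fin_cases j
    · exact h 1 1
    · exact (h 0 1).neg
    · exact (h 1 0).neg
    · exact h 0 0
  refine (hd.mul ha).congr fun p _ => ?_
  rw [Matrix.inv_def, Ring.inverse_eq_inv', Matrix.smul_apply, smul_eq_mul]

theorem pd_eq_sum_pd_comp {u : E2 → ℝ} {p : E2} (hΨ : DifferentiableAt ℝ Ψ p)
    (hdet : (jacobian Ψ p).det ≠ 0) (hu : DifferentiableAt ℝ u (Ψ p)) (i : Fin 2) :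
    pd i u (Ψ p) = (jacobian Ψ p)⁻¹ 0 i * pd 0 (u ∘ Ψ) p + (jacobian Ψ p)⁻¹ 1 i * pd 1 (u ∘ Ψ) p := by
  have h := Matrix.mul_nonsing_inv (jacobian Ψ p) (isUnit_iff_ne_zero.2 hdet)
  have h0 : ∀ j, jacobian Ψ p j 0 * (jacobian Ψ p)⁻¹ 0 i + jacobian Ψ p j 1 * (jacobian Ψ p)⁻¹ 1 i =
      (1 : Matrix (Fin 2) (Fin 2) ℝ) j i := fun j => by
    rw [← h, Matrix.mul_apply, Fin.sum_univ_two]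
  rw [pd_comp hu hΨ, pd_comp hu hΨ]
  have e : ∀ i, pd i u (Ψ p) = pd 0 u (Ψ p) * (1 : Matrix (Fin 2) (Fin 2) ℝ) 0 i +
      pd 1 u (Ψ p) * (1 : Matrix (Fin 2) (Fin 2) ℝ) 1 i :=
    Fin.forall_fin_two.2 ⟨by simp, by simp⟩
  rw [e i, ← h0, ← h0]
  ring

/-- The coefficients of the first derivatives that arise from the principal part. -/
noncomputable def firstOrderPart (Ψ : E2 → E2) (A : Fin 2 → Fin 2 → E2 → ℝ) (k : Fin 2) (p : E2) : ℝ :=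
  ∑ i, ∑ j, A i j (Ψ p) * ∑ q, (jacobian Ψ p)⁻¹ q j * pd q (fun z => (jacobian Ψ z)⁻¹ k i) p

/-- The coefficients of the first derivatives that arise from the first-order part. -/
noncomputable def tildeB (Ψ : E2 → E2) (B : Fin 2 → E2 → ℝ) (k : Fin 2) (p : E2) : ℝ :=
  ∑ j, B j (Ψ p) * (jacobian Ψ p)⁻¹ k j

/-- The inverted chain rule `pd_eq_sum_pd_comp` is applied twice. Derivatives falling on the inverse
Jacobian matrix produce `firstOrderPart`, and symmetry of second derivatives merges the two mixed
terms. -/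
theorem opL_comp (hS : IsOpen S) (hΨ : ContDiffOn ℝ ∞ Ψ S)
    (hdet : ∀ p ∈ S, (jacobian Ψ p).det ≠ 0) (φ : E2 → ℝ) (A : Fin 2 → Fin 2 → E2 → ℝ)
    (B : Fin 2 → E2 → ℝ) (C : E2 → ℝ) {u : E2 → ℝ} {p : E2} (hp : p ∈ S)
    (hu : ContDiffAt ℝ 2 u (Ψ p)) :
    opL φ A B C u (Ψ p) = φ (Ψ p) *
      (tildeA Ψ A 0 0 p * pd 0 (pd 0 (u ∘ Ψ)) p +
        (tildeA Ψ A 0 1 p + tildeA Ψ A 1 0 p) * pd 0 (pd 1 (u ∘ Ψ)) p +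
        tildeA Ψ A 1 1 p * pd 1 (pd 1 (u ∘ Ψ)) p +
        firstOrderPart Ψ A 0 p * pd 0 (u ∘ Ψ) p + firstOrderPart Ψ A 1 p * pd 1 (u ∘ Ψ) p +
        C (Ψ p) * u (Ψ p)) +
      tildeB Ψ B 0 p * pd 0 (u ∘ Ψ) p + tildeB Ψ B 1 p * pd 1 (u ∘ Ψ) p := by
  have hΨp : ContDiffAt ℝ ∞ Ψ p := hΨ.contDiffAt (hS.mem_nhds hp)
  have hΨd : ∀ z ∈ S, DifferentiableAt ℝ Ψ z := fun z hz =>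
    (hΨ.contDiffAt (hS.mem_nhds hz)).differentiableAt (by simp)
  have hv : ContDiffAt ℝ 2 (u ∘ Ψ) p := hu.comp p (mod_cast contDiffAt_infty.1 hΨp 2)
  have hvd : ∀ k, DifferentiableAt ℝ (pd k (u ∘ Ψ)) p := fun k =>
    (contDiffAt_pd (m := 1) hv (by norm_num) k).differentiableAt one_ne_zero
  have hM : ∀ i j, DifferentiableAt ℝ (fun z => (jacobian Ψ z)⁻¹ i j) p := fun i j =>
    ((contDiffOn_jacobian_inv hS hΨ hdet i j).contDiffAt (hS.mem_nhds hp)).differentiableAt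
      (by simp)
  have hu1 : ∀ᶠ ξ in nhds (Ψ p), DifferentiableAt ℝ u ξ := by
    filter_upwards [hu.eventually (by simp)] with ξ hξ
    exact hξ.differentiableAt (by simp)
  have hpu : ∀ i, DifferentiableAt ℝ (pd i u) (Ψ p) := fun i =>
    (contDiffAt_pd (m := 1) hu (by norm_num) i).differentiableAt one_ne_zero
  have h1 : ∀ i, pd i u (Ψ p) = (jacobian Ψ p)⁻¹ 0 i * pd 0 (u ∘ Ψ) p +
      (jacobian Ψ p)⁻¹ 1 i * pd 1 (u ∘ Ψ) p := fun i =>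
    pd_eq_sum_pd_comp (hΨd p hp) (hdet p hp) hu1.self_of_nhds i
  have h2 : ∀ q i, pd q (pd i u ∘ Ψ) p =
      ((jacobian Ψ p)⁻¹ 0 i * pd q (pd 0 (u ∘ Ψ)) p +
        pd q (fun z => (jacobian Ψ z)⁻¹ 0 i) p * pd 0 (u ∘ Ψ) p) +
      ((jacobian Ψ p)⁻¹ 1 i * pd q (pd 1 (u ∘ Ψ)) p +
        pd q (fun z => (jacobian Ψ z)⁻¹ 1 i) p * pd 1 (u ∘ Ψ) p) := fun q i => by
    have he : (pd i u ∘ Ψ) =ᶠ[nhds p] fun z => (jacobian Ψ z)⁻¹ 0 i * pd 0 (u ∘ Ψ) z +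
        (jacobian Ψ z)⁻¹ 1 i * pd 1 (u ∘ Ψ) z := by
      filter_upwards [hS.mem_nhds hp, hΨp.continuousAt.eventually hu1] with z hz hz'
      exact pd_eq_sum_pd_comp (hΨd z hz) (hdet z hz) hz' i
    rw [pd_congr he, pd_add ((hM 0 i).fun_mul (hvd 0)) ((hM 1 i).fun_mul (hvd 1)),
      pd_mul (hM 0 i) (hvd 0), pd_mul (hM 1 i) (hvd 1)]
  have h3 : ∀ i j, pd j (pd i u) (Ψ p) = (jacobian Ψ p)⁻¹ 0 j * pd 0 (pd i u ∘ Ψ) p +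
      (jacobian Ψ p)⁻¹ 1 j * pd 1 (pd i u ∘ Ψ) p := fun i j =>
    pd_eq_sum_pd_comp (hΨd p hp) (hdet p hp) (hpu i) j
  simp only [opL, tildeA, firstOrderPart, tildeB, Fin.sum_univ_two, h3, h2, h1,
    pd_comm hv 1 0]
  ring

end Transformation

/-- This coefficient is the quadratic form of `A` at the second row of the inverse Jacobian matrix,
and a row of an invertible matrix is nonzero. -/
theorem tildeA_one_one_pos {X : E2 → E2} {A : Fin 2 → Fin 2 → E2 → ℝ} {s : E2} {lam : ℝ}
    (hlam : 0 < lam)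
    (hell : ∀ η : E2, lam * ‖η‖ ^ 2 ≤ ∑ i, ∑ j, A i j (X s) * η i * η j)
    (hdet : (jacobian X s).det ≠ 0) : 0 < tildeA X A 1 1 s := by
  set η : E2 := WithLp.toLp 2 fun j => (jacobian X s)⁻¹ 1 j with hη
  have h0 : η ≠ 0 := fun h => by
    have h1 := Matrix.nonsing_inv_mul (jacobian X s) (isUnit_iff_ne_zero.2 hdet)
    have h2 : ∀ j, (jacobian X s)⁻¹ 1 j = 0 := fun j => congrArg (fun v : E2 => v j) h
    have h3 := congrFun (congrFun h1 1) 1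
    rw [Matrix.mul_apply, Fin.sum_univ_two, h2, h2] at h3
    simp at h3
  exact (mul_pos hlam (pow_pos (norm_pos_iff.2 h0) 2)).trans_le (hell η)

section Coefficients

variable {S : Set E2} {X : E2 → E2} {Ω : Set E2} {A : Fin 2 → Fin 2 → E2 → ℝ}
  {B : Fin 2 → E2 → ℝ} {P : ℝ}

theorem contDiffOn_tildeA (hS : IsOpen S) (hX : ContDiffOn ℝ ∞ X S)
    (hdet : ∀ p ∈ S, (jacobian X p).det ≠ 0) (hXΩ : Set.MapsTo X S Ω)
    (hA : ∀ i j, ContDiffOn ℝ ∞ (A i j) Ω) (i j : Fin 2) : ContDiffOn ℝ ∞ (tildeA X A i j) S :=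
  ContDiffOn.sum fun l _ => ContDiffOn.sum fun r _ =>
    (((hA l r).comp hX hXΩ).mul (contDiffOn_jacobian_inv hS hX hdet i l)).mul
      (contDiffOn_jacobian_inv hS hX hdet j r)

theorem contDiffOn_firstOrderPart (hS : IsOpen S) (hX : ContDiffOn ℝ ∞ X S)
    (hdet : ∀ p ∈ S, (jacobian X p).det ≠ 0) (hXΩ : Set.MapsTo X S Ω)
    (hA : ∀ i j, ContDiffOn ℝ ∞ (A i j) Ω) (k : Fin 2) : ContDiffOn ℝ ∞ (firstOrderPart X A k) S :=
  ContDiffOn.sum fun i _ => ContDiffOn.sum fun j _ => ((hA i j).comp hX hXΩ).mul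
    (ContDiffOn.sum fun q _ => (contDiffOn_jacobian_inv hS hX hdet q j).mul
      (contDiffOn_pd hS (contDiffOn_jacobian_inv hS hX hdet k i) q))

theorem contDiffOn_tildeB (hS : IsOpen S) (hX : ContDiffOn ℝ ∞ X S)
    (hdet : ∀ p ∈ S, (jacobian X p).det ≠ 0) (hXΩ : Set.MapsTo X S Ω)
    (hB : ∀ j, ContDiffOn ℝ ∞ (B j) Ω) (k : Fin 2) : ContDiffOn ℝ ∞ (tildeB X B k) S :=
  ContDiffOn.sum fun j _ => ((hB j).comp hX hXΩ).mul (contDiffOn_jacobian_inv hS hX hdet k j)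

theorem PeriodicFst.tildeA (h : PeriodicFst P X) (i j : Fin 2) :
    PeriodicFst P (tildeA X A i j) := fun x y => by
  simp only [_root_.tildeA, h x y, h.jacobian x y]

theorem PeriodicFst.firstOrderPart (h : PeriodicFst P X) (k : Fin 2) :
    PeriodicFst P (firstOrderPart X A k) := fun x y => by
  have hM : ∀ i q, PeriodicFst P (_root_.pd q fun z => (_root_.jacobian X z)⁻¹ k i) := fun i q =>
    (h.jacobian.comp fun J => J⁻¹ k i).pd q
  simp only [_root_.firstOrderPart, h x y, h.jacobian x y, hM _ _ x y]

theorem PeriodicFst.tildeB (h : PeriodicFst P X) (k : Fin 2) :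
    PeriodicFst P (tildeB X B k) := fun x y => by
  simp only [_root_.tildeB, h x y, h.jacobian x y]

end Coefficients

theorem det_jacobian_comp_shear_ne_zero {X : E2 → E2} {θ : E2 → ℝ} {p : E2}
    (hX : DifferentiableAt ℝ X (shear θ p)) (hθ : ContDiff ℝ ∞ θ)
    (hdet : (jacobian X (shear θ p)).det ≠ 0) (hpos : 0 < pd 0 θ p) :
    (jacobian (X ∘ shear θ) p).det ≠ 0 := by
  rw [jacobian_comp hX ((contDiff_shear hθ).differentiable (by simp) p), Matrix.det_mul,
    jacobian_shear, Matrix.det_fin_two_of]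
  simpa using ⟨hdet, hpos.ne'⟩

theorem jacobian_comp_shear_inv {X : E2 → E2} {θ : E2 → ℝ} {p : E2}
    (hX : DifferentiableAt ℝ X (shear θ p)) (hθ : ContDiff ℝ ∞ θ) (hpos : 0 < pd 0 θ p)
    (j : Fin 2) :
    (jacobian (X ∘ shear θ) p)⁻¹ 0 j = ((jacobian X (shear θ p))⁻¹ 0 j -
      pd 1 θ p * (jacobian X (shear θ p))⁻¹ 1 j) / pd 0 θ p ∧
    (jacobian (X ∘ shear θ) p)⁻¹ 1 j = (jacobian X (shear θ p))⁻¹ 1 j := by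
  rw [jacobian_comp hX ((contDiff_shear hθ).differentiable (by simp) p), Matrix.mul_inv_rev,
    jacobian_shear, Matrix.inv_def, Matrix.det_fin_two_of, Matrix.adjugate_fin_two_of]
  have := hpos.ne'
  constructor
  · simp [Matrix.mul_apply, Fin.sum_univ_two]
    field_simp
    ring
  · simp [Matrix.mul_apply, Fin.sum_univ_two]
    field_simp

/-- Along characteristic coordinates the symmetrized mixed principal coefficient vanishes. -/
theorem tildeA_comp_shear_mixed {X : E2 → E2} {A : Fin 2 → Fin 2 → E2 → ℝ} {θ : E2 → ℝ} {p : E2}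
    (hX : DifferentiableAt ℝ X (shear θ p)) (hθ : ContDiff ℝ ∞ θ) (hpos : 0 < pd 0 θ p)
    (h : tildeA X A 0 1 (shear θ p) + tildeA X A 1 0 (shear θ p) =
      2 * pd 1 θ p * tildeA X A 1 1 (shear θ p)) :
    tildeA (X ∘ shear θ) A 0 1 p + tildeA (X ∘ shear θ) A 1 0 p = 0 := by
  have hi := jacobian_comp_shear_inv hX hθ hpos
  have := hpos.ne'
  -- By the formula for the inverse matrix, the new symmetrized coefficient is `(Ã¹² + Ã²¹ - 2 θ_y
  -- Ã²²) / θ_x`.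
  simp only [tildeA, Fin.sum_univ_two, (hi _).1, (hi _).2, Function.comp_apply] at h ⊢
  field_simp
  linear_combination h

theorem isSmoothPeriodic_of {f : E2 → ℝ} {d e : ℝ} (hde : d < e) (hf : ContDiffOn ℝ ∞ f (strip e))
    (hp : PeriodicFst (2 * Real.pi) f) : IsSmoothPeriodic f d :=
  ⟨hf.mono (closedStrip_subset_strip hde), fun x y _ => hp x y⟩

/-! ### The normal form -/

theorem lemma2p1 (Ω : Set E2) (hΩ : IsOpen Ω)
    (φ : E2 → ℝ) (A : Fin 2 → Fin 2 → E2 → ℝ) (B : Fin 2 → E2 → ℝ) (C : E2 → ℝ)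
    (hφ : ContDiffOn ℝ ∞ φ Ω) (hA : ∀ i j, ContDiffOn ℝ ∞ (A i j) Ω)
    (hB : ∀ k, ContDiffOn ℝ ∞ (B k) Ω) (hC : ContDiffOn ℝ ∞ C Ω)
    (lam : ℝ) (hlam : 0 < lam)
    (hell : ∀ ξ ∈ Ω, ∀ η : E2, lam * ‖η‖ ^ 2 ≤ ∑ i, ∑ j, A i j ξ * η i * η j)
    (Γ : Set E2) (hΓ : Γ = {ξ | ξ ∈ Ω ∧ φ ξ = 0}) (hcurve : IsSmoothClosedCurve Γ)
    (hgrad : ∀ ξ ∈ Γ, gradient φ ξ ≠ 0) :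
    ∃ (ν : ℝ → E2) (l d₀ : ℝ) (ψ : E2 → ℝ) (Ψ : E2 → E2) (w a b c m : E2 → ℝ),
      -- the tubular neighbourhood of the curve and its normal coordinates
      IsArcLengthParam ν l Γ ∧ 0 < d₀ ∧
      IsOpen (tube φ ν d₀) ∧ Γ ⊆ tube φ ν d₀ ∧ tube φ ν d₀ ⊆ Ω ∧
      IsPeriodicChart (normalCoord φ ν) l d₀ (tube φ ν d₀) ∧
      -- the Cauchy problem
      SolvesCauchy (normalCoord φ ν) A l d₀ ψ ∧ (∀ s ∈ strip d₀, 0 < pd 0 ψ s) ∧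
      -- the new coordinates are x = 2πψ/l - π, y = s₂, and Ψ is the inverse of Φ
      IsPeriodicChart Ψ (2 * Real.pi) d₀ (tube φ ν d₀) ∧
      Ψ '' periodCell d₀ = tube φ ν d₀ ∧
      (∀ s ∈ strip d₀, Ψ !₂[2 * Real.pi / l * ψ s - Real.pi, s 1] = normalCoord φ ν s) ∧
      -- the coefficients of the normal form
      IsSmoothPeriodic w d₀ ∧ IsSmoothPeriodic a d₀ ∧ IsSmoothPeriodic b d₀ ∧
      IsSmoothPeriodic c d₀ ∧ IsSmoothPeriodic m d₀ ∧ (∀ p ∈ closedStrip d₀, 0 < m p) ∧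
      -- the operators agree up to the factor m at every point where u is of class C²
      (∀ p ∈ strip d₀, ∀ u : E2 → ℝ, ContDiffAt ℝ 2 u (Ψ p) →
        opNormalForm w a b c (u ∘ Ψ) p = m p * opL φ A B C u (Ψ p)) ∧
      -- the equation Lu = F becomes the normal form with right-hand side f = m (F ∘ Ψ)
      ∀ F : E2 → ℝ, ∃ f : E2 → ℝ,
        (∀ p ∈ strip d₀, f p = m p * F (Ψ p)) ∧
        (∀ x y : ℝ, |y| < d₀ → f !₂[x + 2 * Real.pi, y] = f !₂[x, y]) ∧
        ∀ u : E2 → ℝ, ContDiffOn ℝ 2 u (tube φ ν d₀) →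
          ((∀ ξ ∈ tube φ ν d₀, opL φ A B C u ξ = F ξ) ↔
            ∀ p ∈ periodCell d₀, opNormalForm w a b c (u ∘ Ψ) p = f p) := by
  obtain ⟨ν, l, hν⟩ := exists_arcLengthParam hcurve
  obtain ⟨hXs, hXp, d₁, hd₁, hXΩ, hXdet, hXiff, h, hh, hhp, hφh⟩ :=
    exists_tubular hΩ hφ hΓ hgrad hν
  have hl : 0 < l := hν.1
  have hrange : Set.range ν = Γ := hν.2.2.2.2.2
  have hpi := Real.pi_pos
  have haxis : ∀ x, normalCoord φ ν !₂[x, 0] = ν x := normalCoord_axis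
  have htube : ∀ d, tube φ ν d = normalCoord φ ν '' strip d := fun d => rfl
  set X := normalCoord φ ν with hX
  have hXd : ∀ s, DifferentiableAt ℝ X s := fun s => hXs.differentiable (by simp) s
  have hA11 : ∀ s ∈ strip d₁, 0 < tildeA X A 1 1 s := fun s hs =>
    tildeA_one_one_pos hlam (hell _ (hXΩ s hs)) (hXdet s hs)
  have hAs := contDiffOn_tildeA (isOpen_strip d₁) hXs.contDiffOn hXdet hXΩ hA
  have hAp : ∀ i j, PeriodicFst l (tildeA X A i j) := hXp.tildeA
  -- the characteristic slope, extended to the plane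
  have hmin : 0 < min d₁ 1 := lt_min hd₁ one_pos
  have hg₀ : ContDiffOn ℝ ∞ (fun s => (tildeA X A 0 1 s + tildeA X A 1 0 s) / 2 /
      tildeA X A 1 1 s) (strip (min d₁ 1)) :=
    ((((hAs 0 1).add (hAs 1 0)).div_const 2).div (hAs 1 1) fun s hs => (hA11 s hs).ne').mono
      (strip_mono (min_le_left _ _))
  -- The outer half-width is capped at `1` because the flow is built for slopes that vanish for
  -- `|s₂| ≥ 1`. On the inner strip, of half that width, `g` is the true slope.
  obtain ⟨g, hg, hgeq, hg0, hgp⟩ := exists_extension (half_pos hmin) (half_lt_self hmin) hg₀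
  have hgp' : PeriodicFst l g := hgp l fun x y _ => by rw [hAp, hAp, hAp]
  -- With `r = l / (2π)` and `c = π` the normalized variable `ψ / r - c` is `2πψ / l - π`, of period
  -- `l / r = 2π`.
  obtain ⟨ψ, θ, hψ, hθ, hψ0, hψp, hψpos, hψeq, hθpos, hθeq, hθp, hψθ, hθψ⟩ :=
    exists_characteristic_coordinates (r := l / (2 * Real.pi)) (c := Real.pi) hg hl
      (by positivity) hgp' fun p hp => hg0 p ((min_le_right _ _).trans hp)
  have hlr : l / (l / (2 * Real.pi)) = 2 * Real.pi := by field_simp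
  rw [hlr] at hθp
  set e := min d₁ 1 / 2 with he
  have he0 : 0 < e := half_pos hmin
  have hed₁ : e ≤ d₁ := (half_le_self hmin.le).trans (min_le_left _ _)
  have hsub : strip e ⊆ strip d₁ := strip_mono hed₁
  have hgA : ∀ s ∈ strip e, (tildeA X A 0 1 s + tildeA X A 1 0 s) / 2 =
      g s * tildeA X A 1 1 s := fun s hs => by
    rw [hgeq s (strip_subset_closedStrip _ hs), div_mul_cancel₀ _ (hA11 s (hsub hs)).ne']
  -- the inverse of the transformation
  set Ψ : E2 → E2 := X ∘ shear θ with hΨ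
  have hΨs : ContDiff ℝ ∞ Ψ := hXs.comp (contDiff_shear hθ)
  have hΨp : PeriodicFst (2 * Real.pi) Ψ := fun x y => by
    change X !₂[θ !₂[x + 2 * Real.pi, y], y] = X !₂[θ !₂[x, y], y]
    rw [hθp, hXp]
  have hΨdet : ∀ p ∈ strip e, (jacobian Ψ p).det ≠ 0 := fun p hp =>
    det_jacobian_comp_shear_ne_zero (hXd _) hθ (hXdet _ (hsub hp)) (hθpos p)
  have hΨΩ : Set.MapsTo Ψ (strip e) Ω := fun p hp => hXΩ (shear θ p) (hsub hp)
  have hΨψ : ∀ s, Ψ !₂[2 * Real.pi / l * ψ s - Real.pi, s 1] = X s := fun s => by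
    have h1 := hθψ s
    rw [div_div_eq_mul_div, mul_comm (ψ s), mul_div_right_comm] at h1
    change X !₂[θ !₂[2 * Real.pi / l * ψ s - Real.pi, s 1], s 1] = X s
    rw [h1, E2.eta]
  have hΨim : ∀ d, Ψ '' strip d = tube φ ν d := fun d => by
    rw [htube]
    refine Set.Subset.antisymm ?_ ?_
    · rintro _ ⟨p, hp, rfl⟩
      exact ⟨shear θ p, hp, rfl⟩
    · rintro _ ⟨s, hs, rfl⟩
      exact ⟨!₂[2 * Real.pi / l * ψ s - Real.pi, s 1], hs, hΨψ s⟩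
  have hcell : ∀ d, Ψ '' periodCell d = tube φ ν d := fun d => by
    rw [← hΨim]
    refine Set.Subset.antisymm (Set.image_mono fun p hp => abs_lt.2 hp.2) ?_
    rintro _ ⟨p, hp, rfl⟩
    obtain ⟨k, hk⟩ := exists_add_int_mul_mem_Ico (mul_pos two_pos hpi) (p 0 + Real.pi)
    refine ⟨!₂[p 0 + k * (2 * Real.pi), p 1], ⟨⟨?_, ?_⟩, abs_lt.1 hp⟩, ?_⟩
    · change -Real.pi ≤ p 0 + k * (2 * Real.pi)
      linarith [hk.1]
    · change p 0 + k * (2 * Real.pi) ≤ Real.pi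
      linarith [hk.2]
    · rw [hΨp.int, E2.eta]
  have hΨiff : ∀ p ∈ strip e, ∀ q ∈ strip e,
      Ψ p = Ψ q ↔ p 1 = q 1 ∧ ∃ k : ℤ, q 0 = p 0 + k * (2 * Real.pi) := fun p hp q hq => by
    constructor
    · intro hpq
      obtain ⟨h1, k, hk⟩ := (hXiff (shear θ p) (hsub hp) (shear θ q) (hsub hq)).1 hpq
      change p 1 = q 1 at h1
      change θ q = θ p + k * l at hk
      refine ⟨h1, k, ?_⟩
      -- Applying `ψ` undoes `θ` up to the affine map `r (x + π)`, so a shift of `θ` by `k l`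
      -- becomes a shift of `x` by `2πk`.
      have hψint : ψ (shear θ q) = ψ (shear θ p) + k * l := by
        change ψ !₂[θ q, q 1] = ψ !₂[θ p, p 1] + k * l
        have hper : PeriodicFst l fun s => ψ s - s 0 := fun x y => by
          change ψ !₂[x + l, y] - (x + l) = ψ !₂[x, y] - x
          rw [hψp]; ring
        have h2 : ψ !₂[θ p + k * l, p 1] - (θ p + k * l) = ψ !₂[θ p, p 1] - θ p :=
          hper.int k (θ p) (p 1)
        rw [hk, ← h1]
        linarith
      rw [hψθ, hψθ] at hψint
      field_simp at hψint
      linarith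
    · rintro ⟨h1, k, hk⟩
      rw [← E2.eta q, hk, ← h1, hΨp.int, E2.eta]
  have hmixed : ∀ p ∈ strip e, tildeA Ψ A 0 1 p + tildeA Ψ A 1 0 p = 0 := fun p hp =>
    tildeA_comp_shear_mixed (hXd _) hθ (hθpos p) (by
      have := hgA (shear θ p) hp
      rw [hθeq]
      linarith)
  have hT11 : ∀ p ∈ strip e, 0 < tildeA Ψ A 1 1 p := fun p hp =>
    tildeA_one_one_pos hlam (hell _ (hΨΩ hp)) (hΨdet p hp)
  -- the coefficients
  have hTs := contDiffOn_tildeA (isOpen_strip e) hΨs.contDiffOn hΨdet hΨΩ hA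
  have hEs := contDiffOn_firstOrderPart (isOpen_strip e) hΨs.contDiffOn hΨdet hΨΩ hA
  have hBs := contDiffOn_tildeB (isOpen_strip e) hΨs.contDiffOn hΨdet hΨΩ hB
  have hTp : ∀ i j, PeriodicFst (2 * Real.pi) (tildeA Ψ A i j) := hΨp.tildeA
  have hEp : ∀ k, PeriodicFst (2 * Real.pi) (firstOrderPart Ψ A k) := hΨp.firstOrderPart
  have hBp : ∀ k, PeriodicFst (2 * Real.pi) (tildeB Ψ B k) := hΨp.tildeB
  have hTne : ∀ p ∈ strip e, tildeA Ψ A 1 1 p ≠ 0 := fun p hp => (hT11 p hp).ne'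
  set H : E2 → ℝ := fun p => h (shear θ p) with hH
  have hHs : ContDiff ℝ ∞ H := hh.comp (contDiff_shear hθ)
  have hHp : PeriodicFst (2 * Real.pi) H := fun x y => by
    change h !₂[θ !₂[x + 2 * Real.pi, y], y] = h !₂[θ !₂[x, y], y]
    rw [hθp, hhp]
  have hHpos : ∀ p ∈ strip e, 0 < H p := fun p hp => (hφh (shear θ p) (hsub hp)).1
  have hφH : ∀ p ∈ strip e, φ (Ψ p) = p 1 * H p := fun p hp => (hφh (shear θ p) (hsub hp)).2
  -- In the new coordinates `v_yy` carries the factor `φ ∘ Ψ · Ã²² = y H Ã²²`. Multiplying by `m`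
  -- reduces it to `y`.
  set m : E2 → ℝ := fun p => (H p * tildeA Ψ A 1 1 p)⁻¹ with hm
  have hmpos : ∀ p ∈ strip e, 0 < m p := fun p hp => inv_pos.2 (mul_pos (hHpos p hp) (hT11 p hp))
  have hms : ContDiffOn ℝ ∞ m (strip e) := (hHs.contDiffOn.mul (hTs 1 1)).inv fun p hp =>
    (mul_pos (hHpos p hp) (hT11 p hp)).ne'
  have hmp : PeriodicFst (2 * Real.pi) m := hHp.comp₂ (hTp 1 1) fun x y => (x * y)⁻¹
  set w : E2 → ℝ := fun p => tildeA Ψ A 0 0 p / tildeA Ψ A 1 1 p with hw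
  set co : Fin 2 → E2 → ℝ := fun k p =>
    p 1 * firstOrderPart Ψ A k p / tildeA Ψ A 1 1 p + m p * tildeB Ψ B k p with hco
  set c : E2 → ℝ := fun p => C (Ψ p) / tildeA Ψ A 1 1 p with hc
  have hcos : ∀ k, ContDiffOn ℝ ∞ (co k) (strip e) := fun k =>
    (((E2.contDiff_apply 1).contDiffOn.mul (hEs k)).div (hTs 1 1) hTne).add (hms.mul (hBs k))
  have hcop : ∀ k, PeriodicFst (2 * Real.pi) (co k) := fun k x y => by
    simp only [hco, hTp 1 1 x y, hEp k x y, hBp k x y, hmp x y]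
    rfl
  -- The width is halved so that the closed strip lies inside the open strip on which the
  -- coefficients are smooth and `m > 0`.
  have hde : e / 2 < e := half_lt_self he0
  have hd₀ : 0 < e / 2 := half_pos he0
  have hsub' : strip (e / 2) ⊆ strip e := strip_mono hde.le
  have hopen : IsOpen (tube φ ν (e / 2)) := isOpen_image_of_det_ne_zero (isOpen_strip _)
    hXs.contDiffOn fun s hs => hXdet s (hsub (hsub' hs))
  have hop : ∀ p ∈ strip (e / 2), ∀ u : E2 → ℝ, ContDiffAt ℝ 2 u (Ψ p) →
      opNormalForm w (co 0) (co 1) c (u ∘ Ψ) p = m p * opL φ A B C u (Ψ p) := by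
    intro p hp u hu
    rw [opL_comp (isOpen_strip e) hΨs.contDiffOn hΨdet φ A B C (hsub' hp) hu,
      hmixed p (hsub' hp), hφH p (hsub' hp)]
    have h1 := (hHpos p (hsub' hp)).ne'
    have h2 := hTne p (hsub' hp)
    simp only [opNormalForm, hw, hco, hc, hm, Function.comp_apply]
    field_simp
    ring
  refine ⟨ν, l, e / 2, ψ, Ψ, w, co 0, co 1, c, m, hν, hd₀, hopen, ?_, ?_, ?_, ?_,
    fun s _ => hψpos s, ?_, hcell _, fun s _ => hΨψ s,
    isSmoothPeriodic_of hde ((hTs 0 0).div (hTs 1 1) hTne)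
      ((hTp 0 0).comp₂ (hTp 1 1) fun x y => x / y),
    isSmoothPeriodic_of hde (hcos 0) (hcop 0), isSmoothPeriodic_of hde (hcos 1) (hcop 1),
    isSmoothPeriodic_of hde ((hC.comp hΨs.contDiffOn hΨΩ).div (hTs 1 1) hTne)
      ((hΨp.comp C).comp₂ (hTp 1 1) fun x y => x / y),
    isSmoothPeriodic_of hde hms hmp, fun p hp => hmpos p (closedStrip_subset_strip hde hp), hop,
    fun F => ⟨fun p => m p * F (Ψ p), fun p _ => rfl, fun x y _ => ?_, fun u hu => ?_⟩⟩
  · rw [← hrange]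
    rintro _ ⟨x, rfl⟩
    exact ⟨!₂[x, 0], by rw [mk_mem_strip, abs_zero]; exact hd₀, haxis x⟩
  · rintro _ ⟨s, hs, rfl⟩
    exact hXΩ s (hsub (hsub' hs))
  · exact ⟨hXs.contDiffOn, rfl, fun s hs => hXdet s (hsub (hsub' hs)), fun s hs t ht =>
      hXiff s (hsub (hsub' hs)) t (hsub (hsub' ht))⟩
  · refine ⟨hψ.contDiffOn, fun s hs => ?_, hψ0, fun x y _ => hψp x y⟩
    rw [hgA s (hsub' hs)]
    linear_combination tildeA X A 1 1 s * hψeq s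
  · exact ⟨hΨs.contDiffOn, hΨim _, fun p hp => hΨdet p (hsub' hp), fun p hp q hq =>
      hΨiff p (hsub' hp) q (hsub' hq)⟩
  · simp only [hmp x y, hΨp x y]
  · have hu' : ∀ p ∈ strip (e / 2), ContDiffAt ℝ 2 u (Ψ p) := fun p hp =>
      hu.contDiffAt (hopen.mem_nhds (hΨim (e / 2) ▸ Set.mem_image_of_mem Ψ hp))
    constructor
    · intro hL p hp
      have hp' : p ∈ strip (e / 2) := abs_lt.2 hp.2
      rw [hop p hp' u (hu' p hp'), hL _ (hcell (e / 2) ▸ Set.mem_image_of_mem Ψ hp)]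
    -- The period cell already covers the tube, and `m ≠ 0` can be cancelled.
    · intro hN ξ hξ
      rw [← hcell (e / 2)] at hξ
      obtain ⟨p, hp, rfl⟩ := hξ
      have hp' : p ∈ strip (e / 2) := abs_lt.2 hp.2
      have := hN p hp
      rw [hop p hp' u (hu' p hp')] at this
      exact mul_left_cancel₀ (hmpos p (hsub' hp')).ne' this
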